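/- **Setting.** On $\mathbb R^3$ let $A=\sqrt{-\Delta}$, $\langle A\rangle=(1+A^2)^{1/2}$, and for $r\ge 0$ let $H^r$ be the Sobolev space with norm $\|f\|_{H^r}=\|\langle A\rangle^r f\|_{L^2}$; vector fields carry the norms $\|u\|^2=\sum_{j=1}^3\|u_j\|^2$ (real- and complex-valued fields are both allowed). Let $P$ be the Leray projection, i.e. multiplication in Fourier space by $P(\xi)=I-|\hat\xi\rangle\langle\hat\xi|$, $\hat\xi=\xi/|\xi|$. For $0<T<\infty$ and $I=\,]0,T]$, a *strong solution* on $I$ of the Navier–Stokes equations, written $u\in\mathcal S_{r,I}$, is a function $u\in C([0,T],(H^r)^3)$ such that 1. $u(t)\in P(H^r)^3$ for all $t\in[0,T]$; 2. $t\mapsto t^{3/8}A^{5/4}u(t)$ is a bounded continuous function from $]0,T]$ to $(L^2)^3$, and $t^{3/8}\|A^{5/4}u(t)\|_{L^2}\to0$ as $t\to0$; 3. $u\in C^1(]0,T],\mathcal S'(\mathbb R^3))$ (weak* topology on $\mathcal S'$) and $\frac{d}{dt}u=-A^2u-P(u\cdot\nabla)u$ for $t\in\,]0,T]$ in the sense of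 distributions. For $f\in H^r$ the *analyticity radius* $\mathrm{rad}(f)\in[0,\infty]$ is the supremum of all $a>0$ for which the $H^r$-valued map $\eta\mapsto f(\cdot+\eta)$, $\eta\in\mathbb R^3$, extends to a bounded analytic $H^r$-valued function on $\{\eta\in\mathbb C^3:|\mathrm{Im}\,\eta|<a\}$ (and $\mathrm{rad}(f)=0$ if there is no such $a$). For $f\in(H^r)^3$, $\mathrm{rad}(f)=\min_j\mathrm{rad}(f_j)$. **Theorem 1.2.** Let $1/2<r<3/2$, $u_0\in(H^r)^3$, and let $u\in\mathcal S_{r,I}$, $I=\,]0,T]$, be the strong solution with $u(0)=u_0$. Let $\epsilon\in\,]0,2r-1]$. Then there are constants $t_0>0$ and $C>0$ depending only on $\epsilon$, $r$ and $\|u_0\|_{H^r}$ (bounded uniformly, respectively bounded away from $0$ in the case of $t_0$, for $\|u_0\|_{H^r}$ in bounded sets) such that, for all $t\in\,]0,\min(t_0,T)]$, $$e^{\sqrt{2r-1-\epsilon}\,\sqrt{t|\ln t|}\,A}u(t)\in (H^r)^3,\qquad \big\|e^{\sqrt{2r-1-\epsilon}\,\sqrt{t|\ln t|}\,A}u(t)\big\|_{(H^r)^3}\le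 C\,t^{1/4+\epsilon/4-r/2}.$$ In particular $$\liminf_{t\to0}\frac{\mathrm{rad}(u(t))}{\sqrt{t|\ln t|}}\ge\sqrt{2r-1}.$$ -/

import Mathlib

open MeasureTheory Filter Topology Set
open scoped FourierTransform SchwartzMap LineDeriv Laplacian ENNReal

noncomputable section

namespace NavierStokes

/-- Physical space `ℝ³` with the Euclidean norm. -/
abbrev E3 : Type := EuclideanSpace ℝ (Fin 3)

/-- The complex Hilbert space `L²(ℝ³)`. -/
abbrev L2 : Type := Lp ℂ 2 (volume : Measure E3)

/-- `FunctionOfA m f g` says that `f` is in the domain of `m(A)` and `g = m(A) f`, where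
`A = √(-Δ)`. With the convention `𝓕 f ξ = ∫ exp(-2πi x·ξ) f(x) dx`, the operator `A` is
multiplication by `2π|ξ|` in Fourier space. -/
def FunctionOfA (m : ℝ → ℝ) (f g : L2) : Prop :=
  ∀ᵐ ξ : E3, (𝓕 g : L2) ξ = (m (2 * Real.pi * ‖ξ‖) : ℂ) * (𝓕 f : L2) ξ

/-- The symbol `⟨2πξ⟩ ^ r = (1 + |2πξ|²) ^ (r / 2)` of `⟨A⟩ ^ r`. -/
def besselSymbol (r : ℝ) (ξ : E3) : ℝ := (1 + (2 * Real.pi * ‖ξ‖) ^ 2) ^ (r / 2)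

/-- The domain of `⟨A⟩ ^ r` in `L²(ℝ³)`. -/
def sobolevSubmodule (r : ℝ) : Submodule ℂ L2 where
  carrier := {f | MemLp (fun ξ : E3 => (besselSymbol r ξ : ℂ) * (𝓕 f : L2) ξ) 2 volume}
  zero_mem' := by
    have h : (𝓕 (0 : L2) : L2) = 0 := (Lp.fourierTransformₗᵢ E3 ℂ).map_zero
    simp only [mem_ofPred_eq, h]
    refine (memLp_congr_ae ?_).mpr (MemLp.zero' (ε := ℂ))
    filter_upwards [Lp.coeFn_zero ℂ 2 (volume : Measure E3)] with ξ hξ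
    rw [hξ]; simp
  add_mem' := by
    intro f g hf hg
    have h : (𝓕 (f + g) : L2) = 𝓕 f + 𝓕 g := (Lp.fourierTransformₗᵢ E3 ℂ).map_add f g
    simp only [mem_ofPred_eq, h] at hf hg ⊢
    refine (memLp_congr_ae ?_).mpr (hf.add hg)
    filter_upwards [Lp.coeFn_add (𝓕 f : L2) (𝓕 g)] with ξ hξ
    rw [hξ, Pi.add_apply, Pi.add_apply, mul_add]
  smul_mem' := by
    intro c f hf
    have h : (𝓕 (c • f) : L2) = c • 𝓕 f := (Lp.fourierTransformₗᵢ E3 ℂ).map_smul c f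
    simp only [mem_ofPred_eq, h] at hf ⊢
    refine (memLp_congr_ae ?_).mpr (hf.const_smul c)
    filter_upwards [Lp.coeFn_smul c (𝓕 f : L2)] with ξ hξ
    simp only [hξ, Pi.smul_apply, smul_eq_mul]
    ring

/-- The Sobolev space `H ^ r(ℝ³)` for `r ≥ 0`, as a space of `L²` functions. -/
def HSob (r : ℝ) : Type := ↥(sobolevSubmodule r)

namespace HSob

variable {r : ℝ}

instance : AddCommGroup (HSob r) := inferInstanceAs (AddCommGroup ↥(sobolevSubmodule r))

instance : Module ℂ (HSob r) := inferInstanceAs (Module ℂ ↥(sobolevSubmodule r))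

/-- The inclusion `H ^ r ⊆ L²`. -/
def toL2 : HSob r →ₗ[ℂ] L2 := (sobolevSubmodule r).subtype

theorem memLp (f : HSob r) :
    MemLp (fun ξ : E3 => (besselSymbol r ξ : ℂ) * (𝓕 f.toL2 : L2) ξ) 2 volume :=
  f.2

/-- The map sending `f` to the Fourier transform of `⟨A⟩ ^ r f`. -/
def weightedFourier : HSob r →ₗ[ℂ] L2 where
  toFun f := f.memLp.toLp _
  map_add' f g := by
    have h : (𝓕 (toL2 (f + g)) : L2) = 𝓕 f.toL2 + 𝓕 g.toL2 := by
      rw [map_add]; exact (Lp.fourierTransformₗᵢ E3 ℂ).map_add _ _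
    rw [← MemLp.toLp_add, MemLp.toLp_eq_toLp_iff]
    filter_upwards [Lp.coeFn_add (𝓕 f.toL2 : L2) (𝓕 g.toL2)] with ξ hξ
    rw [h, hξ, Pi.add_apply, Pi.add_apply, mul_add]
  map_smul' c f := by
    have h : (𝓕 (toL2 (c • f)) : L2) = c • 𝓕 f.toL2 := by
      rw [map_smul]; exact (Lp.fourierTransformₗᵢ E3 ℂ).map_smul _ _
    rw [RingHom.id_apply, ← MemLp.toLp_const_smul, MemLp.toLp_eq_toLp_iff]
    filter_upwards [Lp.coeFn_smul c (𝓕 f.toL2 : L2)] with ξ hξ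
    simp only [h, hξ, Pi.smul_apply, smul_eq_mul]
    ring

theorem besselSymbol_pos (r : ℝ) (ξ : E3) : 0 < besselSymbol r ξ := by
  unfold besselSymbol; positivity

theorem weightedFourier_injective : Function.Injective (weightedFourier (r := r)) := by
  intro f g hfg
  have h1 := (MemLp.toLp_eq_toLp_iff f.memLp g.memLp).mp hfg
  have h2 : (𝓕 f.toL2 : L2) = 𝓕 g.toL2 := by
    apply Lp.ext
    filter_upwards [h1] with ξ hξ
    exact mul_left_cancel₀ (by exact_mod_cast (besselSymbol_pos r ξ).ne') hξ
  exact Subtype.ext ((Lp.fourierTransformₗᵢ E3 ℂ).injective h2)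

/-- The norm `‖f‖_{H ^ r} = ‖⟨A⟩ ^ r f‖_{L²}` (computed in Fourier space). -/
instance : NormedAddCommGroup (HSob r) :=
  NormedAddCommGroup.induced (HSob r) L2 weightedFourier weightedFourier_injective

instance : NormedSpace ℂ (HSob r) := NormedSpace.induced ℂ (HSob r) L2 weightedFourier

end HSob

/-- The space `(H ^ r)³` with its Hilbert norm `(∑ ‖u_j‖²) ^ (1/2)`. -/
abbrev HVec (r : ℝ) : Type := PiLp 2 (fun _ : Fin 3 => HSob r)

/-- The space `(L²)³` with its Hilbert norm. -/
abbrev L2Vec : Type := PiLp 2 (fun _ : Fin 3 => L2)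

/-! ### The Leray projection and strong solutions -/

/-- The matrix `P(ξ) = I - |ξ̂⟩⟨ξ̂|`, `ξ̂ = ξ/|ξ|`, applied to `v ∈ ℂ³`. -/
def leray (ξ : E3) (v : Fin 3 → ℂ) (j : Fin 3) : ℂ :=
  v j - (ξ j : ℂ) * (∑ k, (ξ k : ℂ) * v k) / ((‖ξ‖ ^ 2 : ℝ) : ℂ)

/-- `u ∈ P (H ^ r)³`, that is `P u = u` for the orthogonal projection `P`. -/
def InRangeLeray {r : ℝ} (u : HVec r) : Prop :=
  ∀ᵐ ξ : E3, ∀ j, leray ξ (fun k => (𝓕 (u k).toL2 : L2) ξ) j = (𝓕 (u j).toL2 : L2) ξ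

/-- `D l k` is the partial derivative `∂_l u_k`, in the sense of distributions. -/
def IsGradient {r : ℝ} (u : HVec r) (D : Fin 3 → Fin 3 → L2) : Prop :=
  ∀ l k, (D l k : 𝓢'(E3, ℂ)) = ∂_{EuclideanSpace.single l (1 : ℝ)} ((u k).toL2 : 𝓢'(E3, ℂ))

/-- The `k`-th component of `(u · ∇) u`, where `D l k = ∂_l u_k`. It is integrable, since it is
a sum of products of square integrable functions. -/
def convection {r : ℝ} (u : HVec r) (D : Fin 3 → Fin 3 → L2) (k : Fin 3) : E3 → ℂ :=
  fun x => ∑ l, (u l).toL2 x * D l k x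

/-- The pairing of the `j`-th component of `P (u · ∇) u` with a Schwartz function `φ`. The
Fourier transform of `P (u · ∇) u` is the bounded function `P(ξ) 𝓕((u · ∇) u)(ξ)`, and
`⟨T, φ⟩ = ⟨𝓕 T, 𝓕⁻ φ⟩`. -/
def projectedConvection {r : ℝ} (u : HVec r) (D : Fin 3 → Fin 3 → L2) (j : Fin 3)
    (φ : 𝓢(E3, ℂ)) : ℂ :=
  ∫ ξ : E3, leray ξ (fun k => 𝓕 (convection u D k) ξ) j * (𝓕⁻ φ) ξ

/-- The pairing of the `j`-th component of `-A² u - P (u · ∇) u = Δ u - P (u · ∇) u` with `φ`. -/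
def equationRHS {r : ℝ} (u : HVec r) (D : Fin 3 → Fin 3 → L2) (j : Fin 3)
    (φ : 𝓢(E3, ℂ)) : ℂ :=
  (Δ ((u j).toL2 : 𝓢'(E3, ℂ))) φ - projectedConvection u D j φ

/-- `u ∈ S_{r, I}`, `I = ]0,T]`: `u` is a strong solution on `I` of the Navier-Stokes system
`∂ₜ u + P (u · ∇) u - Δ u = 0`, `u(t) ∈ Ran P`. Only the values of `u` on `[0,T]` matter. -/
structure IsStrongSolution (r T : ℝ) (u : ℝ → HVec r) : Prop where
  /-- `u ∈ C([0,T], (H ^ r)³)`. -/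
  continuousOn : ContinuousOn u (Icc 0 T)
  /-- `u(t) ∈ P (H ^ r)³` for all `t ∈ [0,T]`. -/
  inRange : ∀ t ∈ Icc 0 T, InRangeLeray (u t)
  /-- `t ^ (3/8) A ^ (5/4) u(t)` defines a bounded continuous function from `]0,T]` to `(L²)³`
  that tends to `0` as `t → 0`. -/
  kato : ∃ w : ℝ → L2Vec,
    (∀ t ∈ Ioc 0 T, ∀ j, FunctionOfA (fun a => a ^ (5 / 4 : ℝ)) (u t j).toL2 (w t j)) ∧
    ContinuousOn (fun t : ℝ => ((t ^ (3 / 8 : ℝ) : ℝ) : ℂ) • w t) (Ioc 0 T) ∧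
    (∃ M : ℝ, ∀ t ∈ Ioc 0 T, t ^ (3 / 8 : ℝ) * ‖w t‖ ≤ M) ∧
    Tendsto (fun t : ℝ => t ^ (3 / 8 : ℝ) * ‖w t‖) (𝓝[>] 0) (𝓝 0)
  /-- `u ∈ C¹(]0,T], 𝓢')` for the weak* topology, and `du/dt = -A² u - P (u · ∇) u`. -/
  equation : ∃ D : ℝ → Fin 3 → Fin 3 → L2,
    (∀ t ∈ Ioc 0 T, IsGradient (u t) (D t)) ∧
    ∀ (j : Fin 3) (φ : 𝓢(E3, ℂ)),
      (∀ t ∈ Ioc 0 T, HasDerivWithinAt (fun s => ((u s j).toL2 : 𝓢'(E3, ℂ)) φ)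
        (equationRHS (u t) (D t) j φ) (Ioc 0 T) t) ∧
      ContinuousOn (fun t => equationRHS (u t) (D t) j φ) (Ioc 0 T)

/-! ### The analyticity radius -/

/-- The tube `{η ∈ ℂ³ : |Im η| < a}`. -/
def tube (a : ℝ) : Set (EuclideanSpace ℂ (Fin 3)) :=
  {η | ‖(WithLp.toLp 2 (fun i => (η i).im) : E3)‖ < a}

/-- The `H ^ r`-valued map `η ↦ f(· + η)` on `ℝ³` extends to a bounded analytic (holomorphic)
`H ^ r`-valued function on the tube `|Im η| < a`. -/
def HasBoundedExtension {r : ℝ} (f : HSob r) (a : ℝ) : Prop :=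
  ∃ F : EuclideanSpace ℂ (Fin 3) → HSob r,
    DifferentiableOn ℂ F (tube a) ∧
    (∀ y : E3, ∀ᵐ x : E3, (F (WithLp.toLp 2 (fun i => (y i : ℂ)))).toL2 x = f.toL2 (x + y)) ∧
    ∃ M : ℝ, ∀ η ∈ tube a, ‖F η‖ ≤ M

/-- The analyticity radius `rad f ∈ [0,∞]`; it is `0` if `f` is not uniformly real analytic. -/
def rad {r : ℝ} (f : HSob r) : ℝ≥0∞ :=
  ⨆ (a : ℝ) (_ : 0 < a ∧ HasBoundedExtension f a), ENNReal.ofReal a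

/-- The analyticity radius `min_j rad (u_j)` of a vector field. -/
def radVec {r : ℝ} (u : HVec r) : ℝ≥0∞ := ⨅ j, rad (u j)

end NavierStokes

end

/-!
For a time `t` and a slope `μ ≥ 0`, follow the norm of `exp(s μ A) u(s)` in `H ^ r` for
`0 ≤ s ≤ t`. In Duhamel's formula the heat kernel absorbs the growth of the weight: for
`k = |2πξ|` the symbol `exp(τ μ k - τ k²)` is at most `exp(τ μ² / 4)`, and derivatives are paid
for by powers of `τ` (`heatFactor_mul_exp_le`, `multiplier_le`). The weight `exp(s μ A)` is
submultiplicative, so that the quadratic term is estimated as if there were no weight: `u` being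
divergence free, it is one derivative of `u ⊗ u` (`enorm_fourier_convection_le`), and
`H ^ r · H ^ r ⊆ H ^ (2r - 3/2)` for `0 < r < 3/2` (`exists_trilinear_bound`). The total loss of
`5/2 - r` derivatives costs `(t - s) ^ (-(5/2 - r)/2)`, which is integrable because `r > 1/2`, and
the integral contributes `t ^ ((2r - 1)/4)` (`exists_apriori_bound`).

With `L = sup_s exp(-s μ² / 4) ‖exp(s μ A) u(s)‖` the outcome is, up to constants,
`L ≤ ‖u₀‖ + (1 + μ √t)² exp(t μ² / 4) t ^ ((2r - 1)/4) L²`. For `t μ = √(2r - 1 - ε) √(t |ln t|)`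
one has `exp(t μ² / 4) = t ^ (-(2r - 1 - ε)/4)`, the coefficient of `L²` is of order
`|ln t| t ^ (ε/4)` and tends to `0`, and a continuity argument bounds `L` by `2 ‖u₀‖`
(`exists_gevreyFourier_bound`), hence `exp(t μ A) u(t)` by a multiple of `t ^ (-(2r - 1 - ε)/4)`
(`exists_gevrey_bound`).

To make `L` finite and continuous in `s` beforehand, `μ A` is replaced by `min(μ A, R)`; this
keeps the weight submultiplicative, and Fatou's lemma removes `R` at the end. The equation is only
known in the sense of distributions, so Duhamel's formula is used in dual form: `u(s)` is paired
with a test function evolved by the backward heat flow (`hasDerivWithinAt_pairing_heatTest`). The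
test functions are smooth and compactly supported in Fourier space, where the heat flow is
invertible, and they are dense enough to recover weighted norms (`norm_le_of_forall_test`).

The statement on the analyticity radius follows as `ε → 0`: if `exp(a A) f ∈ H ^ r`, then
`η ↦ exp(2πi ξ · η) 𝓕 f(ξ)` is the holomorphic extension of the translates of `f` to `|Im η| < a`
(`hasBoundedExtension_of_functionOfA`).
-/

noncomputable section

namespace NavierStokes

/-! ### The Fourier transform on `L²` tested against smooth functions -/

/-- The Fourier transform on `L²` is symmetric against Schwartz functions; no conjugation occurs. -/
theorem integral_mul_fourier (f : L2) (ψ : 𝓢(E3, ℂ)) :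
    ∫ x, (𝓕 ψ) x * f x = ∫ ξ, ψ ξ * (𝓕 f : L2) ξ := by
  have h := congrArg (fun T : 𝓢'(E3, ℂ) => T ψ) (Lp.fourier_toTemperedDistribution_eq f)
  simpa [TemperedDistribution.fourier_apply, Lp.toTemperedDistribution_apply] using h

theorem locallyIntegrable_L2 (f : L2) : LocallyIntegrable f volume :=
  (Lp.memLp f).locallyIntegrable (by norm_num)

/-- The Fourier transform on `L²` is determined by its pairings with compactly supported Schwartz
functions. -/
theorem fourier_eq_of_forall_test {a b : L2}
    (h : ∀ ψ : 𝓢(E3, ℂ), HasCompactSupport ψ → ∫ x, (𝓕 ψ) x * a x = ∫ ξ, ψ ξ * b ξ) :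
    (𝓕 a : L2) = b := by
  apply Lp.ext
  refine ae_eq_of_integral_contDiff_smul_eq (locallyIntegrable_L2 _) (locallyIntegrable_L2 _) ?_
  intro g hg hgs
  have hs : HasCompactSupport (fun x => (g x : ℂ)) := hgs.comp_left (g := fun x : ℝ => (x : ℂ)) rfl
  have hc : ContDiff ℝ (⊤ : ℕ∞) (fun x => (g x : ℂ)) := Complex.ofRealCLM.contDiff.comp hg
  have := h (hs.toSchwartzMap hc) hs
  rw [integral_mul_fourier] at this
  simpa using this

theorem memLp_conj_modulation (f : L2) (ξ : E3) :
    MemLp (fun x => Complex.exp ((2 * Real.pi * inner ℝ x ξ : ℝ) * Complex.I) *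
      (starRingEnd ℂ) (f x)) 2 volume := by
  refine (Lp.memLp f).of_le ?_ (ae_of_all _ fun x => ?_)
  · refine AEStronglyMeasurable.mul (Continuous.aestronglyMeasurable (by fun_prop)) ?_
    exact Complex.continuous_conj.comp_aestronglyMeasurable (Lp.memLp f).1
  · rw [norm_mul, Complex.norm_exp_ofReal_mul_I]; simp

theorem memLp_conj_reflection (f : L2) (ξ : E3) :
    MemLp (fun η => (starRingEnd ℂ) (f (ξ - η))) 2 volume := by
  have h1 : MemLp (fun η => f (ξ - η)) 2 volume :=
    (Lp.memLp f).comp_measurePreserving (Measure.measurePreserving_sub_left volume ξ)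
  refine h1.of_le ?_ (ae_of_all _ fun x => by simp)
  exact Complex.continuous_conj.comp_aestronglyMeasurable h1.1

/-- The Fourier transform of `x ↦ exp(2πi x·ξ) conj(f x)` is `η ↦ conj(𝓕 f (ξ - η))`. -/
theorem fourier_conj_modulation (f : L2) (ξ : E3) :
    (𝓕 ((memLp_conj_modulation f ξ).toLp _) : L2) = (memLp_conj_reflection (𝓕 f) ξ).toLp _ := by
  apply fourier_eq_of_forall_test
  intro ψ hψ
  have hs : HasCompactSupport (fun η => (starRingEnd ℂ) (ψ (ξ - η))) := by
    have := hψ.comp_homeomorph (Homeomorph.subLeft ξ)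
    exact this.comp_left (g := starRingEnd ℂ) (map_zero _)
  have hc : ContDiff ℝ (⊤ : ℕ∞) (fun η => (starRingEnd ℂ) (ψ (ξ - η))) :=
    Complex.conjCLE.contDiff.comp ((ψ.smooth ⊤).comp (contDiff_const.sub contDiff_id))
  set φ : 𝓢(E3, ℂ) := hs.toSchwartzMap hc with hφ
  have hφv : ∀ η, φ η = (starRingEnd ℂ) (ψ (ξ - η)) := fun η => rfl
  have hF : ∀ x, (𝓕 φ) x = Complex.exp ((-(2 * Real.pi * inner ℝ x ξ) : ℝ) * Complex.I) *
      (starRingEnd ℂ) ((𝓕 ψ) x) := by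
    intro x
    rw [SchwartzMap.fourier_coe, SchwartzMap.fourier_coe, Real.fourier_eq', Real.fourier_eq',
      ← integral_conj, ← integral_const_mul, ← integral_sub_left_eq_self _ _ ξ]
    refine integral_congr_ae (ae_of_all _ fun v => ?_)
    simp only [hφv, smul_eq_mul, map_mul, sub_sub_cancel, ← Complex.exp_conj, ← mul_assoc]
    rw [← Complex.exp_add]
    congr 2
    simp only [inner_sub_left, real_inner_comm x ξ, Complex.conj_ofReal, Complex.conj_I]
    push_cast
    ring
  have h1 := integral_mul_fourier f φ
  have h2 := congrArg (starRingEnd ℂ) h1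
  rw [← integral_conj, ← integral_conj] at h2
  calc _ = ∫ x, (starRingEnd ℂ) ((𝓕 φ) x * f x) := by
        refine integral_congr_ae ?_
        filter_upwards [(memLp_conj_modulation f ξ).coeFn_toLp] with x hx
        rw [hx, hF]
        simp only [map_mul, ← Complex.exp_conj, Complex.conj_ofReal, Complex.conj_I,
          Complex.conj_conj]
        push_cast
        ring_nf
    _ = _ := by
        rw [h2, ← integral_sub_left_eq_self _ _ ξ]
        refine integral_congr_ae ?_
        filter_upwards [(memLp_conj_reflection (𝓕 f) ξ).coeFn_toLp] with x hx
        rw [hx]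
        simp [hφv]

/-- The Fourier transform of a product of two `L²` functions is the convolution of their Fourier
transforms; both sides are continuous functions, and they agree everywhere. -/
theorem fourier_mul_apply (f g : L2) (ξ : E3) :
    𝓕 (fun x => f x * g x) ξ = ∫ η, (𝓕 f : L2) (ξ - η) * (𝓕 g : L2) η := by
  have h := Lp.inner_fourier_eq ((memLp_conj_modulation f ξ).toLp _) g
  rw [fourier_conj_modulation, L2.inner_def, L2.inner_def] at h
  rw [Real.fourier_eq']
  have e1 : ∫ x, inner ℂ ((memLp_conj_modulation f ξ).toLp _ x) (g x) =
      ∫ v : E3, Complex.exp (↑(-2 * Real.pi * inner ℝ v ξ) * Complex.I) • (f v * g v) := by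
    refine integral_congr_ae ?_
    filter_upwards [(memLp_conj_modulation f ξ).coeFn_toLp] with x hx
    rw [hx]
    simp only [RCLike.inner_apply, map_mul, ← Complex.exp_conj, Complex.conj_ofReal,
      Complex.conj_I, Complex.conj_conj, smul_eq_mul]
    push_cast
    ring_nf
  have e2 : ∫ x, inner ℂ ((memLp_conj_reflection (𝓕 f) ξ).toLp _ x) ((𝓕 g : L2) x) =
      ∫ η, (𝓕 f : L2) (ξ - η) * (𝓕 g : L2) η := by
    refine integral_congr_ae ?_
    filter_upwards [(memLp_conj_reflection (𝓕 f) ξ).coeFn_toLp] with x hx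
    rw [hx]
    simp [RCLike.inner_apply, mul_comm]
  rw [← e1, ← h, e2]

/-- Translation by `y` is multiplication by `exp(2πi ξ·y)` on the Fourier side. -/
theorem translation_of_fourier_eq {f g : L2} (y : E3)
    (h : ∀ᵐ ξ : E3, (𝓕 g : L2) ξ =
      Complex.exp ((2 * Real.pi * inner ℝ ξ y : ℝ) * Complex.I) * (𝓕 f : L2) ξ) :
    ∀ᵐ x : E3, g x = f (x + y) := by
  have hm : MemLp (fun x => f (x + y)) 2 volume :=
    (Lp.memLp f).comp_measurePreserving (measurePreserving_add_right volume y)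
  have key : (𝓕 (hm.toLp _) : L2) = 𝓕 g := by
    apply fourier_eq_of_forall_test
    intro ψ hψ
    have hs : HasCompactSupport (fun η =>
        Complex.exp ((2 * Real.pi * inner ℝ η y : ℝ) * Complex.I) * ψ η) := hψ.mul_left
    have hc : ContDiff ℝ (⊤ : ℕ∞) (fun η : E3 =>
        Complex.exp ((2 * Real.pi * inner ℝ η y : ℝ) * Complex.I) * ψ η) := by
      refine ContDiff.mul (ContDiff.cexp (ContDiff.mul (Complex.ofRealCLM.contDiff.comp ?_)
        contDiff_const)) (ψ.smooth ⊤)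
      exact contDiff_const.mul (contDiff_id.inner ℝ contDiff_const)
    set φ : 𝓢(E3, ℂ) := hs.toSchwartzMap hc with hφ
    have hφv : ∀ η, φ η = Complex.exp ((2 * Real.pi * inner ℝ η y : ℝ) * Complex.I) * ψ η :=
      fun η => rfl
    have hF : ∀ x, (𝓕 φ) x = (𝓕 ψ) (x - y) := by
      intro x
      rw [SchwartzMap.fourier_coe, SchwartzMap.fourier_coe, Real.fourier_eq', Real.fourier_eq']
      refine integral_congr_ae (ae_of_all _ fun v => ?_)
      simp only [hφv, smul_eq_mul, ← mul_assoc]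
      rw [← Complex.exp_add]
      congr 2
      simp only [inner_sub_right]
      push_cast
      ring
    calc _ = ∫ x, (fun z => (𝓕 ψ) (z - y) * f z) (x + y) := by
          refine integral_congr_ae ?_
          filter_upwards [hm.coeFn_toLp] with x hx
          rw [hx]; simp
      _ = ∫ x, (𝓕 φ) x * f x := by
          refine (integral_add_right_eq_self (μ := volume)
            (fun z => (𝓕 ψ) (z - y) * f z) y).trans ?_
          simp only [hF]
      _ = ∫ ξ, φ ξ * (𝓕 f : L2) ξ := integral_mul_fourier f φ
      _ = _ := by
          refine integral_congr_ae ?_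
          filter_upwards [h] with ξ hξ
          rw [hξ, hφv]; ring
  have h2 : hm.toLp _ = g := (Lp.fourierTransformₗᵢ E3 ℂ).injective key
  rw [← h2]
  exact hm.coeFn_toLp

/-- On the Fourier side, `∂_l u_k` is multiplication by `2πi ξ_l`. -/
theorem IsGradient.fourier_eq {r : ℝ} {u : HVec r} {D : Fin 3 → Fin 3 → L2}
    (h : IsGradient u D) (l k : Fin 3) :
    ∀ᵐ ξ : E3, (𝓕 (D l k) : L2) ξ = 2 * Real.pi * Complex.I * ξ l * (𝓕 (u k).toL2 : L2) ξ := by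
  refine ae_eq_of_integral_contDiff_smul_eq (locallyIntegrable_L2 _) ?_ ?_
  · have : LocallyIntegrable (fun ξ : E3 => (2 * Real.pi * Complex.I * ξ l) • (𝓕 (u k).toL2 : L2) ξ)
        volume := by
      rw [← locallyIntegrableOn_univ]
      exact (locallyIntegrableOn_univ.mpr (locallyIntegrable_L2 _)).continuousOn_smul
        isClosed_univ.isLocallyClosed (Continuous.continuousOn (by fun_prop))
    exact this
  intro g hg hgs
  have hs : HasCompactSupport (fun x => (g x : ℂ)) := hgs.comp_left (g := fun x : ℝ => (x : ℂ)) rfl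
  have hc : ContDiff ℝ (⊤ : ℕ∞) (fun x => (g x : ℂ)) := Complex.ofRealCLM.contDiff.comp hg
  set φ : 𝓢(E3, ℂ) := hs.toSchwartzMap hc with hφ
  have h1 := congrArg (fun T : 𝓢'(E3, ℂ) => T φ) (congrArg (fun T : 𝓢'(E3, ℂ) => 𝓕 T) (h l k))
  simp only [Lp.fourier_toTemperedDistribution_eq, TemperedDistribution.fourier_lineDerivOp_eq,
    Lp.toTemperedDistribution_apply] at h1
  have htg : (fun x : E3 => ((inner ℝ x (EuclideanSpace.single l (1 : ℝ)) : ℝ) : ℂ)).HasTemperateGrowth := by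
    fun_prop
  have hφv : ∀ x, φ x = (g x : ℂ) := fun _ => rfl
  simp [TemperedDistribution.smulLeftCLM_apply_apply, Lp.toTemperedDistribution_apply,
    SchwartzMap.smulLeftCLM_apply_apply htg, hφv] at h1
  simp only [Complex.real_smul]
  rw [h1, ← integral_const_mul]
  refine integral_congr_ae (ae_of_all _ fun x => ?_)
  have : inner ℝ x (EuclideanSpace.single l (1 : ℝ)) = x l := by
    simp [EuclideanSpace.inner_single_right]
  simp only [this]
  ring

/-! ### The equation on the Fourier side -/

theorem norm_leray_le (ξ : E3) (v : Fin 3 → ℂ) (j : Fin 3) :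
    ‖leray ξ v j‖ ≤ 2 * ∑ k, ‖v k‖ := by
  have hc : ∀ i, |ξ i| ≤ ‖ξ‖ := fun i => by simpa using PiLp.norm_apply_le ξ i
  have h1 : ‖v j‖ ≤ ∑ k, ‖v k‖ :=
    Finset.single_le_sum (f := fun k => ‖v k‖) (fun i _ => norm_nonneg _) (Finset.mem_univ j)
  have h2 : ‖∑ k, (ξ k : ℂ) * v k‖ ≤ ‖ξ‖ * ∑ k, ‖v k‖ := by
    rw [Finset.mul_sum]
    refine norm_sum_le_of_le _ fun k _ => ?_
    rw [norm_mul, Complex.norm_real]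
    exact mul_le_mul_of_nonneg_right (hc k) (norm_nonneg _)
  have h3 : ‖(ξ j : ℂ) * (∑ k, (ξ k : ℂ) * v k) / ((‖ξ‖ ^ 2 : ℝ) : ℂ)‖ ≤ ∑ k, ‖v k‖ := by
    have hS : 0 ≤ ∑ k, ‖v k‖ := Finset.sum_nonneg fun i _ => norm_nonneg _
    rw [norm_div, norm_mul, Complex.norm_real, Complex.norm_real]
    rcases eq_or_ne ξ 0 with rfl | hξ
    · simpa using hS
    · have hp : 0 < ‖ξ‖ := norm_pos_iff.mpr hξ
      rw [Real.norm_of_nonneg (by positivity : 0 ≤ ‖ξ‖ ^ 2), div_le_iff₀ (by positivity)]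
      calc ‖ξ j‖ * ‖∑ k, (ξ k : ℂ) * v k‖ ≤ ‖ξ‖ * (‖ξ‖ * ∑ k, ‖v k‖) :=
            mul_le_mul (hc j) h2 (norm_nonneg _) (norm_nonneg _)
        _ = _ := by ring
  calc _ ≤ _ := norm_sub_le _ _
    _ ≤ _ := by linarith

/-- A field in the range of the Leray projection is divergence free. -/
theorem InRangeLeray.sum_mul_eq_zero {r : ℝ} {u : HVec r} (h : InRangeLeray u) :
    ∀ᵐ ξ : E3, ∑ k, (ξ k : ℂ) * (𝓕 (u k).toL2 : L2) ξ = 0 := by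
  have hne : ∀ᵐ ξ : E3, ξ ≠ 0 := by
    simp [ae_iff, measure_singleton]
  filter_upwards [h, hne] with ξ hξ h0
  set v : Fin 3 → ℂ := fun k => (𝓕 (u k).toL2 : L2) ξ with hv
  have h1 : ∀ j, (ξ j : ℂ) * (∑ k, (ξ k : ℂ) * v k) / ((‖ξ‖ ^ 2 : ℝ) : ℂ) = 0 := by
    intro j
    have := hξ j
    rw [leray, sub_eq_self] at this
    exact this
  have hp : ((‖ξ‖ ^ 2 : ℝ) : ℂ) ≠ 0 := by
    exact_mod_cast (pow_pos (norm_pos_iff.mpr h0) 2).ne'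
  by_contra hS
  apply h0
  ext j
  have := h1 j
  rw [div_eq_zero_iff, mul_eq_zero] at this
  rcases this with (h2 | h2) | h2
  · simpa using h2
  · exact absurd h2 hS
  · exact absurd h2 hp

theorem integrable_convolution_fourier (f g : L2) (ξ : E3) :
    Integrable (fun η => f (ξ - η) * g η) volume :=
  MemLp.integrable_mul (p := 2) (q := 2)
    ((Lp.memLp f).comp_measurePreserving (Measure.measurePreserving_sub_left volume ξ)) (Lp.memLp g)

/-- Since `u` is divergence free, `(u · ∇) u = ∇ · (u ⊗ u)`: on the Fourier side the derivative can
be moved from the second factor to the frequency `ξ` of the product. -/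
theorem enorm_fourier_convection_le {r : ℝ} {u : HVec r} {D : Fin 3 → Fin 3 → L2}
    (hD : IsGradient u D) (hu : InRangeLeray u) (k : Fin 3) (ξ : E3) :
    ‖𝓕 (convection u D k) ξ‖ₑ ≤ ENNReal.ofReal (2 * Real.pi * ‖ξ‖) *
      ∑ l, ∫⁻ η, ‖(𝓕 (u l).toL2 : L2) (ξ - η)‖ₑ * ‖(𝓕 (u k).toL2 : L2) η‖ₑ := by
  have hmeas : ∀ l, AEMeasurable (fun η => ‖(𝓕 (u l).toL2 : L2) (ξ - η)‖ₑ *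
      ‖(𝓕 (u k).toL2 : L2) η‖ₑ) volume := fun l =>
    (((Lp.memLp (𝓕 (u l).toL2 : L2)).comp_measurePreserving
      (Measure.measurePreserving_sub_left volume ξ)).1.enorm).mul (Lp.memLp _).1.enorm
  have h1 : 𝓕 (convection u D k) ξ =
      ∑ l, ∫ η, (𝓕 (u l).toL2 : L2) (ξ - η) * (𝓕 (D l k) : L2) η := by
    simp_rw [← fourier_mul_apply, Real.fourier_eq, convection, Finset.smul_sum]
    refine integral_finsetSum _ fun l _ => ?_
    rw [Real.fourierIntegral_convergent_iff]
    exact MemLp.integrable_mul (Lp.memLp (u l).toL2) (Lp.memLp (D l k))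
  rw [h1, ← integral_finsetSum _ fun l _ => integrable_convolution_fourier _ _ ξ,
    ← lintegral_finsetSum' _ fun l _ => hmeas l,
    ← lintegral_const_mul'' _ (Finset.aemeasurable_fun_sum _ fun l _ => hmeas l)]
  refine (enorm_integral_le_lintegral_enorm _).trans (lintegral_mono_ae ?_)
  have hdiv := (Measure.measurePreserving_sub_left (volume : Measure E3) ξ).quasiMeasurePreserving.ae
    hu.sum_mul_eq_zero
  have hgr : ∀ᵐ η : E3, ∀ l, (𝓕 (D l k) : L2) η =
      2 * Real.pi * Complex.I * η l * (𝓕 (u k).toL2 : L2) η :=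
    ae_all_iff.mpr fun l => hD.fourier_eq l k
  filter_upwards [hdiv, hgr] with η h2 h3
  have h4 : ∑ l, (𝓕 (u l).toL2 : L2) (ξ - η) * (𝓕 (D l k) : L2) η =
      ∑ l, (2 * Real.pi * Complex.I * ξ l) * ((𝓕 (u l).toL2 : L2) (ξ - η) *
        (𝓕 (u k).toL2 : L2) η) := by
    have : ∑ l, (2 * Real.pi * Complex.I * ξ l) * ((𝓕 (u l).toL2 : L2) (ξ - η) *
        (𝓕 (u k).toL2 : L2) η) - ∑ l, (𝓕 (u l).toL2 : L2) (ξ - η) * (𝓕 (D l k) : L2) η =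
        (2 * Real.pi * Complex.I * (𝓕 (u k).toL2 : L2) η) *
        ∑ l, ((ξ - η) l : ℂ) * (𝓕 (u l).toL2 : L2) (ξ - η) := by
      rw [← Finset.sum_sub_distrib, Finset.mul_sum]
      refine Finset.sum_congr rfl fun l _ => ?_
      rw [h3 l, PiLp.sub_apply]
      push_cast
      ring
    rw [h2, mul_zero, sub_eq_zero] at this
    exact this.symm
  rw [h4, Finset.mul_sum]
  refine (enorm_sum_le _ _).trans (Finset.sum_le_sum fun l _ => ?_)
  rw [enorm_mul, enorm_mul ((𝓕 (u l).toL2 : L2) (ξ - η))]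
  gcongr
  rw [← ofReal_norm]
  apply ENNReal.ofReal_le_ofReal
  have hc : |ξ l| ≤ ‖ξ‖ := by simpa using PiLp.norm_apply_le ξ l
  simp only [norm_mul, Complex.norm_real, Complex.norm_I, Complex.norm_ofNat, mul_one,
    Real.norm_eq_abs, abs_of_pos Real.pi_pos]
  gcongr

/-- The pairing of the nonlinear term with a test function on the Fourier side. -/
def nonlinearPairing {r : ℝ} (u : HVec r) (D : Fin 3 → Fin 3 → L2) (j : Fin 3) (ψ : E3 → ℂ) : ℂ :=
  ∫ ξ : E3, leray ξ (fun k => 𝓕 (convection u D k) ξ) j * ψ ξ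

theorem equationRHS_fourier {r : ℝ} (u : HVec r) (D : Fin 3 → Fin 3 → L2) (j : Fin 3)
    (ψ : 𝓢(E3, ℂ)) :
    equationRHS u D j (𝓕 ψ) = -(∫ ξ, ((2 * Real.pi * ‖ξ‖) ^ 2 : ℝ) * ψ ξ * (𝓕 (u j).toL2 : L2) ξ) -
      nonlinearPairing u D j ψ := by
  have h1 : (Δ ((u j).toL2 : 𝓢'(E3, ℂ))) (𝓕 ψ) =
      -(∫ ξ, ((2 * Real.pi * ‖ξ‖) ^ 2 : ℝ) * ψ ξ * (𝓕 (u j).toL2 : L2) ξ) := by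
    have htg : (fun x : E3 => ((‖x‖ ^ 2 : ℝ) : ℂ)).HasTemperateGrowth := by fun_prop
    rw [TemperedDistribution.laplacian_eq_fourierMultiplierCLM,
      TemperedDistribution.fourierMultiplierCLM_apply, Lp.fourier_toTemperedDistribution_eq]
    simp only [smul_apply, TemperedDistribution.fourierInv_apply,
      FourierTransform.fourierInv_fourier_eq, TemperedDistribution.smulLeftCLM_apply_apply,
      Lp.toTemperedDistribution_apply, SchwartzMap.smulLeftCLM_apply_apply htg, smul_eq_mul]
    rw [← integral_smul, ← integral_neg]
    refine integral_congr_ae (ae_of_all _ fun x => ?_)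
    simp only [Complex.real_smul]
    push_cast
    ring
  rw [equationRHS, h1, projectedConvection, nonlinearPairing,
    FourierTransform.fourierInv_fourier_eq]

/-- The weak form of the equation, tested against `𝓕 ψ`. -/
theorem hasDerivWithinAt_fourier_pairing {r T : ℝ} {u : ℝ → HVec r} {D : ℝ → Fin 3 → Fin 3 → L2}
    {j : Fin 3} {s : ℝ} (ψ : 𝓢(E3, ℂ))
    (h : HasDerivWithinAt (fun σ => ((u σ j).toL2 : 𝓢'(E3, ℂ)) (𝓕 ψ))
        (equationRHS (u s) (D s) j (𝓕 ψ)) (Ioc 0 T) s) :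
    HasDerivWithinAt (fun σ => ∫ ξ, ψ ξ * (𝓕 (u σ j).toL2 : L2) ξ)
      (-(∫ ξ, ((2 * Real.pi * ‖ξ‖) ^ 2 : ℝ) * ψ ξ * (𝓕 (u s j).toL2 : L2) ξ) -
      nonlinearPairing (u s) (D s) j ψ) (Ioc 0 T) s := by
  rw [equationRHS_fourier] at h
  simpa only [Lp.toTemperedDistribution_apply, smul_eq_mul, integral_mul_fourier] using h

/-! ### Heat-evolved test functions -/

/-- The symbol `exp(-τ |2πξ|²)` of the heat semigroup at time `τ`. -/
def heatFactor (τ : ℝ) (ξ : E3) : ℝ := Real.exp (-(τ * (2 * Real.pi * ‖ξ‖) ^ 2))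

theorem heatFactor_pos (τ : ℝ) (ξ : E3) : 0 < heatFactor τ ξ := Real.exp_pos _

theorem contDiff_heatFactor (τ : ℝ) : ContDiff ℝ (⊤ : ℕ∞) (heatFactor τ) := by
  unfold heatFactor
  simp_rw [mul_pow]
  exact Real.contDiff_exp.comp ((contDiff_const.mul (contDiff_const.mul (contDiff_norm_sq ℝ))).neg)

theorem hasCompactSupport_heatFactor_mul {ψ : E3 → ℂ} (hs : HasCompactSupport ψ) (τ : ℝ) :
    HasCompactSupport (fun ξ => (heatFactor τ ξ : ℂ) * ψ ξ) := hs.mul_left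

theorem contDiff_heatFactor_mul {ψ : E3 → ℂ} (hc : ContDiff ℝ (⊤ : ℕ∞) ψ) (τ : ℝ) :
    ContDiff ℝ (⊤ : ℕ∞) (fun ξ => (heatFactor τ ξ : ℂ) * ψ ξ) :=
  (Complex.ofRealCLM.contDiff.comp (contDiff_heatFactor τ)).mul hc

/-- The test function `exp(-τ |2πξ|²) ψ(ξ)`, for an arbitrary real `τ`. -/
def heatTest {ψ : E3 → ℂ} (hs : HasCompactSupport ψ) (hc : ContDiff ℝ (⊤ : ℕ∞) ψ) (τ : ℝ) :
    𝓢(E3, ℂ) :=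
  (hasCompactSupport_heatFactor_mul hs τ).toSchwartzMap (contDiff_heatFactor_mul hc τ)

@[simp]
theorem heatTest_apply {ψ : E3 → ℂ} (hs : HasCompactSupport ψ) (hc : ContDiff ℝ (⊤ : ℕ∞) ψ)
    (τ : ℝ) (ξ : E3) : heatTest hs hc τ ξ = (heatFactor τ ξ : ℂ) * ψ ξ := rfl

theorem coeFn_heatTest_toLp {ψ : E3 → ℂ} (hs : HasCompactSupport ψ) (hc : ContDiff ℝ (⊤ : ℕ∞) ψ)
    (τ : ℝ) : ((heatTest hs hc τ).toLp 2 : L2) =ᵐ[volume] fun ξ => (heatFactor τ ξ : ℂ) * ψ ξ :=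
  (heatTest hs hc τ).coeFn_toLp 2 volume

theorem memLp_laplacian_heatTest {ψ : E3 → ℂ} (hs : HasCompactSupport ψ)
    (hc : ContDiff ℝ (⊤ : ℕ∞) ψ) (τ : ℝ) :
    MemLp (fun ξ : E3 => (((2 * Real.pi * ‖ξ‖) ^ 2 : ℝ) : ℂ) * heatTest hs hc τ ξ) 2 volume := by
  refine Continuous.memLp_of_hasCompactSupport ?_ ?_
  · exact (Complex.continuous_ofReal.comp (by fun_prop)).mul (heatTest hs hc τ).continuous
  · exact (hasCompactSupport_heatFactor_mul hs τ).mul_left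

/-- The compact support of `ψ` keeps `|2πξ|²` bounded, so the heat evolution of `ψ` is differentiable
in `L²` at every real time. -/
theorem hasDerivAt_heatTest {ψ : E3 → ℂ} (hs : HasCompactSupport ψ) (hc : ContDiff ℝ (⊤ : ℕ∞) ψ)
    (t s : ℝ) :
    HasDerivAt (fun σ => ((heatTest hs hc (t - σ)).toLp 2 volume : L2))
      ((memLp_laplacian_heatTest hs hc (t - s)).toLp _) s := by
  obtain ⟨K, hK0, hK⟩ : ∃ K : ℝ, 0 < K ∧ ∀ ξ, ψ ξ ≠ 0 → (2 * Real.pi * ‖ξ‖) ^ 2 ≤ K := by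
    obtain ⟨R, hR0, hR⟩ := hs.isCompact.isBounded.exists_pos_norm_le
    refine ⟨(2 * Real.pi * R) ^ 2, by positivity, fun ξ hξ => ?_⟩
    have := hR ξ (subset_tsupport _ hξ)
    gcongr
  rw [hasDerivAt_iff_isLittleO]
  refine Asymptotics.IsBigO.trans_isLittleO (g := fun σ => ‖σ - s‖ ^ 2) ?_
    (Asymptotics.isLittleO_pow_sub_sub s one_lt_two)
  refine Asymptotics.IsBigO.of_bound (K ^ 2 * ‖((heatTest hs hc (t - s)).toLp 2 volume : L2)‖) ?_
  have hev : ∀ᶠ σ in 𝓝 s, |σ - s| * K ≤ 1 := by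
    have : Tendsto (fun σ => |σ - s| * K) (𝓝 s) (𝓝 (|s - s| * K)) :=
      Continuous.tendsto (by fun_prop) s
    rw [sub_self, abs_zero, zero_mul] at this
    exact this.eventually (Iic_mem_nhds one_pos)
  filter_upwards [hev] with σ hσ
  have hle : ‖((heatTest hs hc (t - σ)).toLp 2 volume : L2) - (heatTest hs hc (t - s)).toLp 2 volume -
      (σ - s) • (memLp_laplacian_heatTest hs hc (t - s)).toLp _‖ ≤
      (K ^ 2 * |σ - s| ^ 2) * ‖((heatTest hs hc (t - s)).toLp 2 volume : L2)‖ := by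
    apply Lp.norm_le_mul_norm_of_ae_le_mul
    filter_upwards [Lp.coeFn_sub (((heatTest hs hc (t - σ)).toLp 2 volume : L2) -
      (heatTest hs hc (t - s)).toLp 2 volume) ((σ - s) • (memLp_laplacian_heatTest hs hc (t - s)).toLp _),
      Lp.coeFn_sub ((heatTest hs hc (t - σ)).toLp 2 volume : L2) ((heatTest hs hc (t - s)).toLp 2 volume),
      Lp.coeFn_smul (σ - s) ((memLp_laplacian_heatTest hs hc (t - s)).toLp _),
      (memLp_laplacian_heatTest hs hc (t - s)).coeFn_toLp, coeFn_heatTest_toLp hs hc (t - σ),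
      coeFn_heatTest_toLp hs hc (t - s)] with ξ h1 h2 h3 h4 h5 h6
    rw [h1, Pi.sub_apply, h2, Pi.sub_apply, h3, Pi.smul_apply, h4, h5, h6, heatTest_apply]
    by_cases hz : ψ ξ = 0
    · simp [hz]
    set q := (2 * Real.pi * ‖ξ‖) ^ 2 with hq
    have hq0 : 0 ≤ q := by positivity
    have hqK := hK ξ hz
    have hx : |(σ - s) * q| ≤ 1 := by
      rw [abs_mul, abs_of_nonneg hq0]
      exact (mul_le_mul_of_nonneg_left hqK (abs_nonneg _)).trans hσ
    have hfac : heatFactor (t - σ) ξ = heatFactor (t - s) ξ * Real.exp ((σ - s) * q) := by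
      rw [heatFactor, heatFactor, ← Real.exp_add]
      congr 1; ring
    have hrw : (heatFactor (t - σ) ξ : ℂ) * ψ ξ - (heatFactor (t - s) ξ : ℂ) * ψ ξ -
        (σ - s) • ((q : ℂ) * ((heatFactor (t - s) ξ : ℂ) * ψ ξ)) =
        ((Real.exp ((σ - s) * q) - 1 - (σ - s) * q : ℝ) : ℂ) *
          ((heatFactor (t - s) ξ : ℂ) * ψ ξ) := by
      rw [hfac, Complex.real_smul]
      push_cast
      ring
    rw [hrw, norm_mul, Complex.norm_real, Real.norm_eq_abs]
    refine mul_le_mul_of_nonneg_right ((Real.abs_exp_sub_one_sub_id_le hx).trans ?_) (norm_nonneg _)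
    rw [mul_pow, ← sq_abs (σ - s), mul_comm]
    gcongr
  refine hle.trans (le_of_eq ?_)
  rw [Real.norm_eq_abs, Real.norm_eq_abs, abs_of_nonneg (by positivity : 0 ≤ |σ - s| ^ 2)]
  ring

/-- The bilinear pairing `∫ f g` on `L²`. -/
def pairing : L2 →L[ℂ] L2 →L[ℂ] ℂ :=
  (ContinuousLinearMap.mul ℂ ℂ).lpPairing volume 2 2

theorem pairing_apply (f g : L2) : pairing f g = ∫ ξ, f ξ * g ξ := by
  rw [pairing, ContinuousLinearMap.lpPairing_eq_integral]
  rfl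

theorem pairing_heatTest {ψ : E3 → ℂ} (hs : HasCompactSupport ψ) (hc : ContDiff ℝ (⊤ : ℕ∞) ψ)
    (τ : ℝ) (f : L2) :
    pairing ((heatTest hs hc τ).toLp 2) f = ∫ ξ, heatTest hs hc τ ξ * f ξ := by
  rw [pairing_apply]
  refine integral_congr_ae ?_
  filter_upwards [(heatTest hs hc τ).coeFn_toLp 2 volume] with ξ h
  rw [h]

/-- Testing against the backward heat evolution of `ψ` removes the linear part of the equation:
only strong continuity of `U` is needed, because the time derivative of the test function exists
in `L²`. -/
theorem hasDerivWithinAt_pairing_heatTest {ψ : E3 → ℂ} (hs : HasCompactSupport ψ)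
    (hc : ContDiff ℝ (⊤ : ℕ∞) ψ) {U : ℝ → L2} {S : Set ℝ} {t s : ℝ} {N : ℂ}
    (hU : ContinuousWithinAt U S s)
    (h : HasDerivWithinAt (fun σ => ∫ ξ, heatTest hs hc (t - s) ξ * U σ ξ)
      (-(∫ ξ, ((2 * Real.pi * ‖ξ‖) ^ 2 : ℝ) * heatTest hs hc (t - s) ξ * U s ξ) - N) S s) :
    HasDerivWithinAt (fun σ => ∫ ξ, heatTest hs hc (t - σ) ξ * U σ ξ) (-N) S s := by
  set Ψ : ℝ → L2 := fun σ => (heatTest hs hc (t - σ)).toLp 2 with hΨ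
  set Ψ' : L2 := (memLp_laplacian_heatTest hs hc (t - s)).toLp _ with hΨ'
  have h1 : HasDerivWithinAt (fun σ => pairing (Ψ σ - Ψ s) (U σ)) (pairing Ψ' (U s)) S s := by
    rw [hasDerivWithinAt_iff_tendsto_slope]
    have hsl : Tendsto (slope Ψ s) (𝓝[S \ {s}] s) (𝓝 Ψ') :=
      (hasDerivAt_iff_tendsto_slope.mp (hasDerivAt_heatTest hs hc t s)).mono_left
        (nhdsWithin_mono _ fun x hx => hx.2)
    have hUt : Tendsto U (𝓝[S \ {s}] s) (𝓝 (U s)) :=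
      hU.tendsto.mono_left (nhdsWithin_mono _ sdiff_subset)
    have hb : Continuous fun p : L2 × L2 => pairing p.1 p.2 := by fun_prop
    refine ((hb.tendsto (Ψ', U s)).comp (hsl.prodMk_nhds hUt)).congr fun σ => ?_
    simp only [Function.comp_apply, slope, vsub_eq_sub, sub_self, map_zero,
      zero_apply, sub_zero]
    rw [ContinuousLinearMap.map_smul_of_tower, smul_apply]
  have h2 : pairing Ψ' (U s) =
      ∫ ξ, ((2 * Real.pi * ‖ξ‖) ^ 2 : ℝ) * heatTest hs hc (t - s) ξ * U s ξ := by
    rw [pairing_apply]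
    refine integral_congr_ae ?_
    filter_upwards [(memLp_laplacian_heatTest hs hc (t - s)).coeFn_toLp] with ξ hξ
    rw [hξ]
  have h3 := h.add h1
  rw [h2] at h3
  have h4 : -(∫ ξ, ((2 * Real.pi * ‖ξ‖) ^ 2 : ℝ) * heatTest hs hc (t - s) ξ * U s ξ) - N +
      ∫ ξ, ((2 * Real.pi * ‖ξ‖) ^ 2 : ℝ) * heatTest hs hc (t - s) ξ * U s ξ = -N := by ring
  rw [h4] at h3
  have h5 : (fun σ => ∫ ξ, heatTest hs hc (t - σ) ξ * U σ ξ) =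
      (fun σ => ∫ ξ, heatTest hs hc (t - s) ξ * U σ ξ) +
        fun σ => pairing (Ψ σ - Ψ s) (U σ) := by
    funext σ
    rw [Pi.add_apply, map_sub, sub_apply, pairing_heatTest, pairing_heatTest]
    ring
  rw [h5]
  exact h3

/-! ### A trilinear estimate in Sobolev spaces -/

theorem lintegral_closedBall_rpow_lt_top {p : ℝ} (hp : -3 < p) :
    ∫⁻ x in Metric.closedBall (0 : E3) 1, ENNReal.ofReal (‖x‖ ^ p) < ∞ := by
  have h : IntegrableOn (fun x : E3 => ‖x‖ ^ p) (Metric.ball 0 2) volume := by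
    refine integrableOn_ball_of_norm_le_rpow (C := 1) (α := -p) (by simp) (by simp; linarith)
      (ae_of_all _ fun x => ?_) (measurable_norm.pow_const p).aestronglyMeasurable
    rw [neg_neg, one_mul, Real.norm_of_nonneg (by positivity)]
  have h2 := (h.mono_set (Metric.closedBall_subset_ball one_lt_two)).lintegral_lt_top
  exact h2

/-- Scaling of the integral of a power over a ball; both sides may be infinite. -/
theorem lintegral_closedBall_rpow (p : ℝ) {ρ : ℝ} (hρ : 0 < ρ) :
    ∫⁻ x in Metric.closedBall (0 : E3) ρ, ENNReal.ofReal (‖x‖ ^ p) =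
      ENNReal.ofReal (ρ ^ (3 + p)) *
        ∫⁻ x in Metric.closedBall (0 : E3) 1, ENNReal.ofReal (‖x‖ ^ p) := by
  have hm : Measurable ((Metric.closedBall (0 : E3) ρ).indicator
      fun x => ENNReal.ofReal (‖x‖ ^ p)) :=
    Measurable.indicator (by fun_prop) measurableSet_closedBall
  have h1 : ∫⁻ x, (Metric.closedBall (0 : E3) ρ).indicator
      (fun x => ENNReal.ofReal (‖x‖ ^ p)) (ρ • x) =
      ENNReal.ofReal ((ρ ^ 3)⁻¹) * ∫⁻ x, (Metric.closedBall (0 : E3) ρ).indicator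
      (fun x => ENNReal.ofReal (‖x‖ ^ p)) x := by
    rw [← lintegral_map hm (measurable_const_smul ρ), Measure.map_addHaar_smul _ hρ.ne',
      lintegral_smul_measure, smul_eq_mul, finrank_euclideanSpace, Fintype.card_fin,
      abs_of_pos (by positivity)]
  have h2 : ∀ x : E3, (Metric.closedBall (0 : E3) ρ).indicator
      (fun x => ENNReal.ofReal (‖x‖ ^ p)) (ρ • x) = ENNReal.ofReal (ρ ^ p) *
      (Metric.closedBall (0 : E3) 1).indicator (fun x => ENNReal.ofReal (‖x‖ ^ p)) x := by
    intro x
    have hiff : ρ • x ∈ Metric.closedBall (0 : E3) ρ ↔ x ∈ Metric.closedBall (0 : E3) 1 := by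
      rw [mem_closedBall_zero_iff, mem_closedBall_zero_iff, norm_smul, Real.norm_of_nonneg hρ.le]
      exact mul_le_iff_le_one_right hρ
    by_cases hx : x ∈ Metric.closedBall (0 : E3) 1
    · rw [indicator_of_mem hx, indicator_of_mem (hiff.mpr hx), norm_smul,
        Real.norm_of_nonneg hρ.le, Real.mul_rpow hρ.le (norm_nonneg _),
        ENNReal.ofReal_mul (by positivity)]
    · rw [indicator_of_notMem hx, indicator_of_notMem (fun h => hx (hiff.mp h)), mul_zero]
  simp_rw [h2] at h1
  rw [lintegral_const_mul _ (Measurable.indicator (by fun_prop) measurableSet_closedBall),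
    lintegral_indicator measurableSet_closedBall, lintegral_indicator measurableSet_closedBall] at h1
  have h3 : ENNReal.ofReal (ρ ^ 3) * ENNReal.ofReal ((ρ ^ 3)⁻¹) = 1 := by
    rw [← ENNReal.ofReal_mul (by positivity), mul_inv_cancel₀ (by positivity), ENNReal.ofReal_one]
  calc _ = ENNReal.ofReal (ρ ^ 3) * (ENNReal.ofReal ((ρ ^ 3)⁻¹) *
        ∫⁻ x in Metric.closedBall (0 : E3) ρ, ENNReal.ofReal (‖x‖ ^ p)) := by
        rw [← mul_assoc, h3, one_mul]
    _ = _ := by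
        rw [← h1, ← mul_assoc, ← ENNReal.ofReal_mul (by positivity), Real.rpow_add hρ]
        norm_cast

theorem rpow_le_of_comparable {x y p : ℝ} (hx : 0 < x) (hp : |p| ≤ 3) (h1 : x / 2 ≤ y)
    (h2 : y ≤ 2 * x) : y ^ p ≤ 8 * x ^ p := by
  have hy : 0 < y := by linarith
  have h8 : (2 : ℝ) ^ |p| ≤ 8 := by
    calc (2 : ℝ) ^ |p| ≤ 2 ^ (3 : ℝ) := Real.rpow_le_rpow_of_exponent_le one_le_two hp
      _ = 8 := by norm_num
  have h3 : (y / x) ^ p ≤ 2 ^ |p| := by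
    rcases le_total 0 p with h | h
    · rw [abs_of_nonneg h]
      exact Real.rpow_le_rpow (by positivity) (by rw [div_le_iff₀ hx]; exact h2) h
    · rw [abs_of_nonpos h]
      calc (y / x) ^ p ≤ (1 / 2) ^ p :=
            Real.rpow_le_rpow_of_nonpos (by norm_num) (by rw [le_div_iff₀ hx]; linarith) h
        _ = 2 ^ (-p) := by rw [one_div, Real.inv_rpow zero_le_two, Real.rpow_neg zero_le_two]
  rw [Real.div_rpow hy.le hx.le, div_le_iff₀ (by positivity)] at h3
  exact h3.trans (mul_le_mul_of_nonneg_right h8 (by positivity))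

/-- The weight `1_{|ξ| ≤ 1} + |ξ| ^ (2r - 3/2)`: the product of two functions in `H ^ r` is, after
removing low frequencies, in the homogeneous Sobolev space of order `2r - 3/2`. If `r < 3/4`, the
second term is singular at `0`, where it has the junk value `0`. -/
def productWeight (r : ℝ) (ξ : E3) : ℝ :=
  (Metric.closedBall (0 : E3) 1).indicator 1 ξ + ‖ξ‖ ^ (2 * r - 3 / 2)

theorem productWeight_nonneg (r : ℝ) (ξ : E3) : 0 ≤ productWeight r ξ :=
  add_nonneg (indicator_nonneg (fun _ _ => zero_le_one) _) (by positivity)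

theorem measurable_productWeight (r : ℝ) : Measurable (productWeight r) :=
  (measurable_one.indicator measurableSet_closedBall).add (by fun_prop)

theorem continuous_besselSymbol (r : ℝ) : Continuous (besselSymbol r) := by
  unfold besselSymbol
  exact Continuous.rpow_const (by fun_prop) fun ξ => Or.inl (by positivity)

theorem one_le_besselSymbol {r : ℝ} (hr : 0 ≤ r) (ξ : E3) : 1 ≤ besselSymbol r ξ :=
  Real.one_le_rpow (by nlinarith [sq_nonneg (2 * Real.pi * ‖ξ‖)]) (by linarith)

theorem norm_rpow_le_besselSymbol {r : ℝ} (hr : 0 ≤ r) (ξ : E3) : ‖ξ‖ ^ r ≤ besselSymbol r ξ := by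
  have h1 : ‖ξ‖ ^ r = (‖ξ‖ ^ 2) ^ (r / 2) := by
    rw [← Real.rpow_natCast, ← Real.rpow_mul (norm_nonneg _)]
    congr 1; push_cast; ring
  rw [h1, besselSymbol]
  refine Real.rpow_le_rpow (by positivity) ?_ (by linarith)
  have hpi : 1 ≤ (2 * Real.pi) ^ 2 := by nlinarith [Real.pi_gt_three]
  rw [mul_pow]
  nlinarith [sq_nonneg ‖ξ‖]

theorem inv_besselSymbol_sq_le {r : ℝ} (hr : 0 ≤ r) {ξ : E3} (hξ : ξ ≠ 0) :
    (besselSymbol r ξ)⁻¹ ^ 2 ≤ ‖ξ‖ ^ (-(2 * r)) := by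
  have hp : 0 < ‖ξ‖ := norm_pos_iff.mpr hξ
  have h1 : ‖ξ‖ ^ (-(2 * r)) = ((‖ξ‖ ^ r)⁻¹) ^ 2 := by
    rw [Real.rpow_neg hp.le, mul_comm, Real.rpow_mul hp.le, inv_pow]
    norm_cast
  rw [h1]
  have h2 := norm_rpow_le_besselSymbol hr ξ
  have h3 : 0 ≤ (besselSymbol r ξ)⁻¹ := inv_nonneg.mpr (HSob.besselSymbol_pos r ξ).le
  gcongr

/-- The pointwise bound behind the Schur test: either `|η| ≤ |ζ|/2`, and then `|ζ + η|` is
comparable to `|ζ|`, or `|η|` is comparable to `|ζ|`. -/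
theorem productWeight_kernel_le {r : ℝ} (hr0 : 0 < r) (hr : r < 3 / 2) {ζ η : E3} (hζ : ζ ≠ 0)
    (hη : η ≠ 0) (h : ‖η‖ ≤ ‖ζ‖) :
    (productWeight r (ζ + η) * (besselSymbol r ζ)⁻¹ * (besselSymbol r η)⁻¹) ^ 2 ≤
      2 * (Metric.closedBall (0 : E3) 1).indicator 1 (ζ + η) +
        16 * ‖ζ‖ ^ (2 * r - 3) * ‖η‖ ^ (-(2 * r)) +
        16 * ‖ζ‖ ^ (-(4 * r)) * ‖ζ + η‖ ^ (4 * r - 3) := by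
  have hz : 0 < ‖ζ‖ := norm_pos_iff.mpr hζ
  have he : 0 < ‖η‖ := norm_pos_iff.mpr hη
  set χ : ℝ := (Metric.closedBall (0 : E3) 1).indicator 1 (ζ + η) with hχ
  have hχ0 : 0 ≤ χ := indicator_nonneg (fun _ _ => zero_le_one) _
  have hχ1 : χ ^ 2 = χ := by
    rw [hχ]; by_cases hm : ζ + η ∈ Metric.closedBall (0 : E3) 1 <;> simp [hm]
  set A := ‖ζ + η‖ ^ (2 * r - 3 / 2) with hA
  have hA0 : 0 ≤ A := by positivity
  have hA2 : A ^ 2 = ‖ζ + η‖ ^ (4 * r - 3) := by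
    rw [hA, ← Real.rpow_natCast, ← Real.rpow_mul (norm_nonneg _)]
    congr 1; push_cast; ring
  have hb1 : 0 ≤ (besselSymbol r ζ)⁻¹ := inv_nonneg.mpr (HSob.besselSymbol_pos r ζ).le
  have hb2 : 0 ≤ (besselSymbol r η)⁻¹ := inv_nonneg.mpr (HSob.besselSymbol_pos r η).le
  have hc1 : (besselSymbol r ζ)⁻¹ ≤ 1 := inv_le_one_of_one_le₀ (one_le_besselSymbol hr0.le ζ)
  have hc2 : (besselSymbol r η)⁻¹ ≤ 1 := inv_le_one_of_one_le₀ (one_le_besselSymbol hr0.le η)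
  have hd1 := inv_besselSymbol_sq_le hr0.le hζ
  have hd2 := inv_besselSymbol_sq_le hr0.le hη
  have hB : (besselSymbol r ζ)⁻¹ ^ 2 * (besselSymbol r η)⁻¹ ^ 2 ≤ 1 :=
    mul_le_one₀ (pow_le_one₀ hb1 hc1) (by positivity) (pow_le_one₀ hb2 hc2)
  have hB2 : (besselSymbol r ζ)⁻¹ ^ 2 * (besselSymbol r η)⁻¹ ^ 2 ≤
      ‖ζ‖ ^ (-(2 * r)) * ‖η‖ ^ (-(2 * r)) := mul_le_mul hd1 hd2 (by positivity) (by positivity)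
  have hmain : A ^ 2 * (‖ζ‖ ^ (-(2 * r)) * ‖η‖ ^ (-(2 * r))) ≤
      8 * ‖ζ‖ ^ (2 * r - 3) * ‖η‖ ^ (-(2 * r)) + 8 * ‖ζ‖ ^ (-(4 * r)) * ‖ζ + η‖ ^ (4 * r - 3) := by
    rw [hA2]
    rcases le_total ‖η‖ (‖ζ‖ / 2) with hc | hc
    · have h1 : ‖ζ + η‖ ^ (4 * r - 3) ≤ 8 * ‖ζ‖ ^ (4 * r - 3) := by
        refine rpow_le_of_comparable hz (abs_le.mpr ⟨by linarith, by linarith⟩) ?_ ?_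
        · have := norm_sub_le (ζ + η) η
          rw [add_sub_cancel_right] at this
          linarith
        · have := norm_add_le ζ η
          linarith
      have h2 : ‖ζ‖ ^ (2 * r - 3) = ‖ζ‖ ^ (4 * r - 3) * ‖ζ‖ ^ (-(2 * r)) := by
        rw [← Real.rpow_add hz]; congr 1; ring
      have h3 : ‖ζ + η‖ ^ (4 * r - 3) * (‖ζ‖ ^ (-(2 * r)) * ‖η‖ ^ (-(2 * r))) ≤
          8 * ‖ζ‖ ^ (4 * r - 3) * (‖ζ‖ ^ (-(2 * r)) * ‖η‖ ^ (-(2 * r))) :=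
        mul_le_mul_of_nonneg_right h1 (by positivity)
      have h4 : 0 ≤ 8 * ‖ζ‖ ^ (-(4 * r)) * ‖ζ + η‖ ^ (4 * r - 3) := by positivity
      rw [h2]; linarith
    · have h1 : ‖η‖ ^ (-(2 * r)) ≤ 8 * ‖ζ‖ ^ (-(2 * r)) :=
        rpow_le_of_comparable hz (abs_le.mpr ⟨by linarith, by linarith⟩) hc (by linarith)
      have h2 : ‖ζ‖ ^ (-(4 * r)) = ‖ζ‖ ^ (-(2 * r)) * ‖ζ‖ ^ (-(2 * r)) := by
        rw [← Real.rpow_add hz]; congr 1; ring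
      have h3 : ‖ζ + η‖ ^ (4 * r - 3) * ‖ζ‖ ^ (-(2 * r)) * ‖η‖ ^ (-(2 * r)) ≤
          ‖ζ + η‖ ^ (4 * r - 3) * ‖ζ‖ ^ (-(2 * r)) * (8 * ‖ζ‖ ^ (-(2 * r))) :=
        mul_le_mul_of_nonneg_left h1 (by positivity)
      have h4 : 0 ≤ 8 * ‖ζ‖ ^ (2 * r - 3) * ‖η‖ ^ (-(2 * r)) := by positivity
      rw [h2]; linarith
  calc (productWeight r (ζ + η) * (besselSymbol r ζ)⁻¹ * (besselSymbol r η)⁻¹) ^ 2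
      = (χ + A) ^ 2 * ((besselSymbol r ζ)⁻¹ ^ 2 * (besselSymbol r η)⁻¹ ^ 2) := by
        rw [productWeight]; ring
    _ ≤ (2 * χ + 2 * A ^ 2) * ((besselSymbol r ζ)⁻¹ ^ 2 * (besselSymbol r η)⁻¹ ^ 2) := by
        refine mul_le_mul_of_nonneg_right ?_ (by positivity)
        nlinarith [sq_nonneg (χ - A)]
    _ ≤ 2 * χ * 1 + 2 * (A ^ 2 * (‖ζ‖ ^ (-(2 * r)) * ‖η‖ ^ (-(2 * r)))) := by
        rw [add_mul, mul_assoc 2 (A ^ 2)]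
        gcongr
    _ ≤ _ := by linarith

/-- The Schur bound for the region `|η| ≤ |ζ|`. All terms of the pointwise bound integrate to constants
independent of `ζ`, since `2r < 3`, `4r - 3 > -3` and the powers of `|ζ|` cancel. -/
theorem exists_lintegral_kernel_le {r : ℝ} (hr0 : 0 < r) (hr : r < 3 / 2) :
    ∃ C : ℝ≥0∞, C ≠ ∞ ∧ ∀ ζ : E3, ζ ≠ 0 → ∫⁻ η in Metric.closedBall (0 : E3) ‖ζ‖,
      ENNReal.ofReal ((productWeight r (ζ + η) * (besselSymbol r ζ)⁻¹ *
        (besselSymbol r η)⁻¹) ^ 2) ≤ C := by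
  set c₁ := ∫⁻ x in Metric.closedBall (0 : E3) 1, ENNReal.ofReal (‖x‖ ^ (-(2 * r))) with hc₁
  set c₂ := ∫⁻ x in Metric.closedBall (0 : E3) 1, ENNReal.ofReal (‖x‖ ^ (4 * r - 3)) with hc₂
  have h1 : c₁ ≠ ∞ := (lintegral_closedBall_rpow_lt_top (by linarith)).ne
  have h2 : c₂ ≠ ∞ := (lintegral_closedBall_rpow_lt_top (by linarith)).ne
  have hv : volume (Metric.closedBall (0 : E3) 1) ≠ ∞ := measure_closedBall_lt_top.ne
  refine ⟨2 * volume (Metric.closedBall (0 : E3) 1) + 16 * c₁ +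
    16 * (ENNReal.ofReal (2 ^ (4 * r)) * c₂), by finiteness, fun ζ hζ => ?_⟩
  have hz : 0 < ‖ζ‖ := norm_pos_iff.mpr hζ
  have hne : ∀ᵐ η : E3, η ≠ 0 := by simp [ae_iff, measure_singleton]
  have hpt : ∀ᵐ η : E3, η ∈ Metric.closedBall (0 : E3) ‖ζ‖ →
      ENNReal.ofReal ((productWeight r (ζ + η) * (besselSymbol r ζ)⁻¹ *
        (besselSymbol r η)⁻¹) ^ 2) ≤
      2 * (Metric.closedBall (0 : E3) 1).indicator 1 (ζ + η) +
        ENNReal.ofReal (16 * ‖ζ‖ ^ (2 * r - 3)) * ENNReal.ofReal (‖η‖ ^ (-(2 * r))) +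
        ENNReal.ofReal (16 * ‖ζ‖ ^ (-(4 * r))) *
          (Metric.closedBall (0 : E3) (2 * ‖ζ‖)).indicator
            (fun x => ENNReal.ofReal (‖x‖ ^ (4 * r - 3))) (ζ + η) := by
    filter_upwards [hne] with η hη hm
    rw [mem_closedBall_zero_iff] at hm
    have hm2 : ζ + η ∈ Metric.closedBall (0 : E3) (2 * ‖ζ‖) := by
      rw [mem_closedBall_zero_iff]
      linarith [norm_add_le ζ η]
    refine (ENNReal.ofReal_le_ofReal (productWeight_kernel_le hr0 hr hζ hη hm)).trans ?_
    rw [indicator_of_mem hm2, ENNReal.ofReal_add (by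
      have : 0 ≤ (Metric.closedBall (0 : E3) 1).indicator (1 : E3 → ℝ) (ζ + η) :=
        indicator_nonneg (fun _ _ => zero_le_one) _
      positivity) (by positivity), ENNReal.ofReal_add (by
      have : 0 ≤ (Metric.closedBall (0 : E3) 1).indicator (1 : E3 → ℝ) (ζ + η) :=
        indicator_nonneg (fun _ _ => zero_le_one) _
      positivity) (by positivity), ENNReal.ofReal_mul (by positivity),
      ENNReal.ofReal_mul (by positivity : 0 ≤ 16 * ‖ζ‖ ^ (2 * r - 3)),
      ENNReal.ofReal_mul (by positivity : 0 ≤ 16 * ‖ζ‖ ^ (-(4 * r)))]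
    gcongr
    · simp
    · by_cases hq : ζ + η ∈ Metric.closedBall (0 : E3) 1 <;> simp [hq]
  have hmi : ∀ (ρ : ℝ) (f : E3 → ℝ≥0∞), Measurable f →
      ∫⁻ η in Metric.closedBall (0 : E3) ‖ζ‖, (Metric.closedBall (0 : E3) ρ).indicator f (ζ + η) ≤
      ∫⁻ x in Metric.closedBall (0 : E3) ρ, f x := by
    intro ρ f hf
    refine (setLIntegral_le_lintegral _ _).trans (le_of_eq ?_)
    rw [lintegral_add_left_eq_self (μ := (volume : Measure E3)) (fun x =>
      (Metric.closedBall (0 : E3) ρ).indicator f x) ζ, lintegral_indicator measurableSet_closedBall]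
  have hm1 : Measurable fun η : E3 => (Metric.closedBall (0 : E3) 1).indicator
      (1 : E3 → ℝ≥0∞) (ζ + η) :=
    (measurable_one.indicator measurableSet_closedBall).comp (measurable_const_add ζ)
  refine (setLIntegral_mono_ae' measurableSet_closedBall hpt).trans ?_
  have hm3 : Measurable fun η : E3 => 2 * (Metric.closedBall (0 : E3) 1).indicator
      (1 : E3 → ℝ≥0∞) (ζ + η) := hm1.const_mul 2
  have hm4 : Measurable fun η : E3 => 2 * (Metric.closedBall (0 : E3) 1).indicator
      (1 : E3 → ℝ≥0∞) (ζ + η) + ENNReal.ofReal (16 * ‖ζ‖ ^ (2 * r - 3)) *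
        ENNReal.ofReal (‖η‖ ^ (-(2 * r))) := hm3.add (Measurable.const_mul (by fun_prop) _)
  rw [lintegral_add_left hm4, lintegral_add_left hm3, lintegral_const_mul _ hm1,
    lintegral_const_mul _ (by fun_prop), lintegral_const_mul' _ _ ENNReal.ofReal_ne_top,
    lintegral_closedBall_rpow _ hz, ← hc₁]
  refine add_le_add (add_le_add ?_ ?_) ?_
  · have := hmi 1 1 measurable_one
    simp only [Pi.one_apply, lintegral_one, Measure.restrict_apply_univ] at this
    gcongr
  · rw [← mul_assoc, ← ENNReal.ofReal_mul (by positivity), mul_assoc, ← Real.rpow_add hz]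
    have e1 : 2 * r - 3 + (3 + -(2 * r)) = 0 := by ring
    rw [e1, Real.rpow_zero]
    norm_num
  · refine (mul_le_mul_right (hmi _ _ (by fun_prop)) _).trans (le_of_eq ?_)
    rw [lintegral_closedBall_rpow _ (by positivity), ← hc₂, ← mul_assoc, ← mul_assoc,
      ← ENNReal.ofReal_mul (by positivity), Real.mul_rpow zero_le_two hz.le]
    have e1 : (3 : ℝ) + (4 * r - 3) = 4 * r := by ring
    have e2 : 16 * ‖ζ‖ ^ (-(4 * r)) * (2 ^ (4 * r) * ‖ζ‖ ^ (4 * r)) = 16 * 2 ^ (4 * r) := by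
      rw [Real.rpow_neg hz.le]
      field_simp
    rw [e1, e2, ENNReal.ofReal_mul (by positivity)]
    norm_num

/-- Schur test: Cauchy-Schwarz pairs `H(ξ) G(η)` with `K(ξ - η, η) F(ξ - η)`. -/
theorem lintegral_trilinear_le_of_kernel {K : E3 → E3 → ℝ≥0∞} (hK : Measurable (Function.uncurry K))
    {C : ℝ≥0∞} (hC : ∀ᵐ ζ : E3, ∫⁻ η, K ζ η ^ (2 : ℝ) ≤ C) {H F G : E3 → ℝ≥0∞} (hH : Measurable H)
    (hF : Measurable F) (hG : Measurable G) :
    ∫⁻ ξ, ∫⁻ η, H ξ * (K (ξ - η) η * F (ξ - η) * G η) ≤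
      C ^ (1 / 2 : ℝ) * ((∫⁻ ξ, H ξ ^ (2 : ℝ)) ^ (1 / 2 : ℝ) * (∫⁻ ξ, F ξ ^ (2 : ℝ)) ^ (1 / 2 : ℝ) *
        (∫⁻ ξ, G ξ ^ (2 : ℝ)) ^ (1 / 2 : ℝ)) := by
  set μ : Measure (E3 × E3) := volume.prod volume with hμ
  set A : E3 × E3 → ℝ≥0∞ := fun p => H p.1 * G p.2 with hA
  set B : E3 × E3 → ℝ≥0∞ := fun p => K (p.1 - p.2) p.2 * F (p.1 - p.2) with hB
  have hAm : Measurable A := by fun_prop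
  have hKm : Measurable fun p : E3 × E3 => K (p.1 - p.2) p.2 :=
    hK.comp ((measurable_fst.sub measurable_snd).prodMk measurable_snd)
  have hBm : Measurable B := hKm.mul (by fun_prop)
  have h1 : ∫⁻ ξ, ∫⁻ η, H ξ * (K (ξ - η) η * F (ξ - η) * G η) = ∫⁻ p, (A * B) p ∂μ := by
    rw [hμ, lintegral_prod _ (hAm.mul hBm).aemeasurable]
    refine lintegral_congr fun ξ => lintegral_congr fun η => ?_
    simp only [Pi.mul_apply, hA, hB]
    ring
  have h2 : ∫⁻ p, A p ^ (2 : ℝ) ∂μ = (∫⁻ ξ, H ξ ^ (2 : ℝ)) * ∫⁻ ξ, G ξ ^ (2 : ℝ) := by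
    rw [← lintegral_prod_mul (by fun_prop) (by fun_prop)]
    refine lintegral_congr fun p => ?_
    rw [hA, ENNReal.mul_rpow_of_nonneg _ _ zero_le_two]
  have h3 : ∫⁻ p, B p ^ (2 : ℝ) ∂μ ≤ C * ∫⁻ ξ, F ξ ^ (2 : ℝ) := by
    rw [hμ, lintegral_prod_symm _ (by fun_prop)]
    have e1 : ∀ η : E3, ∫⁻ ξ, B (ξ, η) ^ (2 : ℝ) = ∫⁻ ζ, (K ζ η * F ζ) ^ (2 : ℝ) := fun η =>
      lintegral_sub_right_eq_self (μ := (volume : Measure E3)) (fun ζ => (K ζ η * F ζ) ^ (2 : ℝ)) η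
    simp_rw [e1]
    rw [lintegral_lintegral_swap
      (((hK.comp measurable_swap).mul (by fun_prop)).pow_const (2 : ℝ)).aemeasurable,
      ← lintegral_const_mul _ (by fun_prop)]
    refine lintegral_mono_ae ?_
    filter_upwards [hC] with ζ hζ
    simp_rw [ENNReal.mul_rpow_of_nonneg _ _ zero_le_two]
    rw [lintegral_mul_const _ (hK.of_uncurry_left.pow_const _)]
    gcongr
  rw [h1]
  refine (ENNReal.lintegral_mul_le_Lp_mul_Lq μ Real.HolderConjugate.two_two hAm.aemeasurable
    hBm.aemeasurable).trans ?_
  rw [h2]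
  calc _ ≤ ((∫⁻ ξ, H ξ ^ (2 : ℝ)) * ∫⁻ ξ, G ξ ^ (2 : ℝ)) ^ (1 / 2 : ℝ) *
        (C * ∫⁻ ξ, F ξ ^ (2 : ℝ)) ^ (1 / 2 : ℝ) := by gcongr
    _ = _ := by
        rw [ENNReal.mul_rpow_of_nonneg _ _ (by norm_num), ENNReal.mul_rpow_of_nonneg _ _ (by norm_num)]
        ring

/-- The trilinear estimate equivalent to `H ^ r · H ^ r ⊆ H ^ (2r - 3/2)`, `0 < r < 3/2`, with an
inhomogeneous correction at low frequencies. -/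
theorem exists_trilinear_bound {r : ℝ} (hr0 : 0 < r) (hr : r < 3 / 2) :
    ∃ C : ℝ≥0∞, C ≠ ∞ ∧ ∀ H F G : E3 → ℝ≥0∞, Measurable H → Measurable F → Measurable G →
      ∫⁻ ξ, ∫⁻ η, H ξ * (ENNReal.ofReal (productWeight r ξ) *
        (ENNReal.ofReal (besselSymbol r (ξ - η))⁻¹ * F (ξ - η)) *
        (ENNReal.ofReal (besselSymbol r η)⁻¹ * G η)) ≤
      C * ((∫⁻ ξ, H ξ ^ (2 : ℝ)) ^ (1 / 2 : ℝ) * (∫⁻ ξ, F ξ ^ (2 : ℝ)) ^ (1 / 2 : ℝ) *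
        (∫⁻ ξ, G ξ ^ (2 : ℝ)) ^ (1 / 2 : ℝ)) := by
  obtain ⟨C, hCt, hC⟩ := exists_lintegral_kernel_le hr0 hr
  set k : E3 → E3 → ℝ := fun ζ η =>
    productWeight r (ζ + η) * (besselSymbol r ζ)⁻¹ * (besselSymbol r η)⁻¹ with hk
  have hbi : ∀ ζ : E3, 0 ≤ (besselSymbol r ζ)⁻¹ := fun ζ =>
    inv_nonneg.mpr (HSob.besselSymbol_pos r ζ).le
  have hk0 : ∀ ζ η, 0 ≤ k ζ η := fun ζ η =>
    mul_nonneg (mul_nonneg (productWeight_nonneg r _) (hbi ζ)) (hbi η)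
  have hbm : Measurable fun ζ : E3 => (besselSymbol r ζ)⁻¹ :=
    (continuous_besselSymbol r).measurable.inv
  have hpm := measurable_productWeight r
  set K : E3 → E3 → ℝ≥0∞ := fun ζ η =>
    {p : E3 × E3 | ‖p.2‖ ≤ ‖p.1‖}.indicator (fun p => ENNReal.ofReal (k p.1 p.2)) (ζ, η) with hKd
  have hKm : Measurable (Function.uncurry K) := by
    refine Measurable.indicator (f := fun p : E3 × E3 => ENNReal.ofReal (k p.1 p.2)) ?_
      (measurableSet_le (by fun_prop) (by fun_prop))
    exact (((hpm.comp (measurable_fst.add measurable_snd)).mul (hbm.comp measurable_fst)).mul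
      (hbm.comp measurable_snd)).ennreal_ofReal
  have hKC : ∀ᵐ ζ : E3, ∫⁻ η, K ζ η ^ (2 : ℝ) ≤ C := by
    have hne : ∀ᵐ η : E3, η ≠ 0 := by simp [ae_iff, measure_singleton]
    filter_upwards [hne] with ζ hζ
    refine le_trans (le_of_eq ?_) (hC ζ hζ)
    rw [← lintegral_indicator measurableSet_closedBall]
    refine lintegral_congr fun η => ?_
    by_cases h : ‖η‖ ≤ ‖ζ‖
    · have h1 : (ζ, η) ∈ {p : E3 × E3 | ‖p.2‖ ≤ ‖p.1‖} := h
      have h2 : η ∈ Metric.closedBall (0 : E3) ‖ζ‖ := mem_closedBall_zero_iff.mpr h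
      rw [indicator_of_mem h2, hKd]
      simp only [indicator_of_mem h1]
      rw [ENNReal.ofReal_rpow_of_nonneg (hk0 ζ η) zero_le_two]
      norm_cast
    · have h1 : (ζ, η) ∉ {p : E3 × E3 | ‖p.2‖ ≤ ‖p.1‖} := h
      have h2 : η ∉ Metric.closedBall (0 : E3) ‖ζ‖ := fun hh => h (mem_closedBall_zero_iff.mp hh)
      rw [indicator_of_notMem h2, hKd]
      simp only [indicator_of_notMem h1]
      simp
  -- by symmetry, the larger of the two frequencies may be put in the first argument of the kernel
  refine ⟨2 * C ^ (1 / 2 : ℝ), by finiteness, fun H F G hH hF hG => ?_⟩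
  have hpt : ∀ ξ η, H ξ * (ENNReal.ofReal (productWeight r ξ) *
        (ENNReal.ofReal (besselSymbol r (ξ - η))⁻¹ * F (ξ - η)) *
        (ENNReal.ofReal (besselSymbol r η)⁻¹ * G η)) ≤
      H ξ * (K (ξ - η) η * F (ξ - η) * G η) + H ξ * (K η (ξ - η) * G η * F (ξ - η)) := by
    intro ξ η
    have e1 : H ξ * (ENNReal.ofReal (productWeight r ξ) *
        (ENNReal.ofReal (besselSymbol r (ξ - η))⁻¹ * F (ξ - η)) *
        (ENNReal.ofReal (besselSymbol r η)⁻¹ * G η)) =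
        H ξ * (ENNReal.ofReal (k (ξ - η) η) * F (ξ - η) * G η) := by
      simp only [hk, sub_add_cancel]
      rw [ENNReal.ofReal_mul (mul_nonneg (productWeight_nonneg r _) (hbi _)),
        ENNReal.ofReal_mul (productWeight_nonneg r _)]
      ring
    rw [e1]
    rcases le_total ‖η‖ ‖ξ - η‖ with h | h
    · have h1 : (ξ - η, η) ∈ {p : E3 × E3 | ‖p.2‖ ≤ ‖p.1‖} := h
      refine le_trans (le_of_eq ?_) le_self_add
      simp only [hKd, indicator_of_mem h1]
    · have h1 : (η, ξ - η) ∈ {p : E3 × E3 | ‖p.2‖ ≤ ‖p.1‖} := h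
      refine le_trans (le_of_eq ?_) le_add_self
      have e2 : k (ξ - η) η = k η (ξ - η) := by simp only [hk]; rw [add_comm]; ring
      simp only [hKd, indicator_of_mem h1, e2]
      ring
  have hKm1 : Measurable fun p : E3 × E3 => K (p.1 - p.2) p.2 :=
    hKm.comp ((measurable_fst.sub measurable_snd).prodMk measurable_snd)
  have hm1 : Measurable fun p : E3 × E3 => H p.1 * (K (p.1 - p.2) p.2 * F (p.1 - p.2) * G p.2) :=
    (hH.comp measurable_fst).mul ((hKm1.mul (by fun_prop)).mul (by fun_prop))
  have e3 : ∀ ξ, ∫⁻ η, H ξ * (K η (ξ - η) * G η * F (ξ - η)) =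
      ∫⁻ η, H ξ * (K (ξ - η) η * G (ξ - η) * F η) := by
    intro ξ
    have := lintegral_sub_left_eq_self (μ := (volume : Measure E3))
      (fun η => H ξ * (K η (ξ - η) * G η * F (ξ - η))) ξ
    simpa only [sub_sub_cancel] using this.symm
  calc _ ≤ ∫⁻ ξ, ∫⁻ η, (H ξ * (K (ξ - η) η * F (ξ - η) * G η) +
        H ξ * (K η (ξ - η) * G η * F (ξ - η))) :=
        lintegral_mono fun ξ => lintegral_mono fun η => hpt ξ η
    _ = (∫⁻ ξ, ∫⁻ η, H ξ * (K (ξ - η) η * F (ξ - η) * G η)) +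
        ∫⁻ ξ, ∫⁻ η, H ξ * (K (ξ - η) η * G (ξ - η) * F η) := by
        rw [← lintegral_add_left hm1.lintegral_prod_right']
        refine lintegral_congr fun ξ => ?_
        have hm2 : Measurable fun η => H ξ * (K (ξ - η) η * F (ξ - η) * G η) :=
          hm1.comp measurable_prodMk_left
        rw [lintegral_add_left hm2, e3]
    _ ≤ _ := by
        refine (add_le_add (lintegral_trilinear_le_of_kernel hKm hKC hH hF hG)
          (lintegral_trilinear_le_of_kernel hKm hKC hH hG hF)).trans (le_of_eq ?_)
        ring

/-! ### Truncated exponential weights and the nonlinear estimate -/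

/-- The truncated Gevrey weight `exp(s min(μ A, R))`, as a symbol. Truncating the exponent rather
than the exponential keeps the weight submultiplicative and Lipschitz in `s`. -/
def gevreyWeight (μ R s : ℝ) (ξ : E3) : ℝ := Real.exp (s * min (μ * (2 * Real.pi * ‖ξ‖)) R)

theorem gevreyWeight_pos (μ R s : ℝ) (ξ : E3) : 0 < gevreyWeight μ R s ξ := Real.exp_pos _

theorem continuous_gevreyWeight (μ R s : ℝ) : Continuous (gevreyWeight μ R s) := by
  unfold gevreyWeight; fun_prop

theorem one_le_gevreyWeight {μ R s : ℝ} (hμ : 0 ≤ μ) (hR : 0 ≤ R) (hs : 0 ≤ s) (ξ : E3) :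
    1 ≤ gevreyWeight μ R s ξ :=
  Real.one_le_exp (mul_nonneg hs (le_min (by positivity) hR))

theorem gevreyWeight_le {μ R s : ℝ} (hs : 0 ≤ s) (ξ : E3) :
    gevreyWeight μ R s ξ ≤ Real.exp (s * R) :=
  Real.exp_le_exp.mpr (mul_le_mul_of_nonneg_left (min_le_right _ _) hs)

/-- Submultiplicativity: `min(μ |·|, R)` is subadditive. -/
theorem gevreyWeight_le_mul {μ R s : ℝ} (hμ : 0 ≤ μ) (hR : 0 ≤ R) (hs : 0 ≤ s) (ξ η : E3) :
    gevreyWeight μ R s ξ ≤ gevreyWeight μ R s (ξ - η) * gevreyWeight μ R s η := by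
  rw [gevreyWeight, gevreyWeight, gevreyWeight, ← Real.exp_add, ← mul_add]
  refine Real.exp_le_exp.mpr (mul_le_mul_of_nonneg_left ?_ hs)
  have h1 : μ * (2 * Real.pi * ‖ξ‖) ≤
      μ * (2 * Real.pi * ‖ξ - η‖) + μ * (2 * Real.pi * ‖η‖) := by
    have := norm_add_le (ξ - η) η
    rw [sub_add_cancel] at this
    rw [← mul_add, ← mul_add]
    gcongr
  have h2 : 0 ≤ μ * (2 * Real.pi * ‖ξ - η‖) := by positivity
  have h3 : 0 ≤ μ * (2 * Real.pi * ‖η‖) := by positivity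
  rcases le_total (μ * (2 * Real.pi * ‖ξ - η‖)) R with a | a <;>
    rcases le_total (μ * (2 * Real.pi * ‖η‖)) R with b | b <;>
    simp only [min_eq_left, min_eq_right, a, b, min_le_iff]
  · left; exact h1
  · right; linarith
  · right; linarith
  · right; linarith

theorem gevreyWeight_le_exp_mul {μ R s t : ℝ} (hst : s ≤ t) (ξ : E3) :
    gevreyWeight μ R t ξ ≤
      Real.exp ((t - s) * (μ * (2 * Real.pi * ‖ξ‖))) * gevreyWeight μ R s ξ := by
  rw [gevreyWeight, gevreyWeight, ← Real.exp_add]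
  refine Real.exp_le_exp.mpr ?_
  have := mul_le_mul_of_nonneg_left (min_le_left (μ * (2 * Real.pi * ‖ξ‖)) R)
    (sub_nonneg.mpr hst)
  linarith

/-- Completing the square: `τ μ k - τ k² = τ μ² / 4 - τ (k - μ / 2)²`. -/
theorem heatFactor_mul_exp_le {τ : ℝ} (hτ : 0 ≤ τ) (μ : ℝ) (ξ : E3) :
    heatFactor τ ξ * Real.exp (τ * (μ * (2 * Real.pi * ‖ξ‖))) ≤ Real.exp (τ * μ ^ 2 / 4) := by
  rw [heatFactor, ← Real.exp_add]
  refine Real.exp_le_exp.mpr ?_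
  nlinarith [mul_nonneg hτ (sq_nonneg (2 * Real.pi * ‖ξ‖ - μ / 2))]

/-- Completing the square, `l x - x² = l² / 4 - (x - l / 2)²`. -/
theorem one_add_sq_mul_exp_le (x l : ℝ) (hl : 0 ≤ l) :
    (1 + x ^ 2) * Real.exp (l * x - x ^ 2) ≤ 4 * (1 + l) ^ 2 * Real.exp (l ^ 2 / 4) := by
  set y := x - l / 2 with hy
  have h1 : l * x - x ^ 2 = -(y ^ 2) + l ^ 2 / 4 := by rw [hy]; ring
  rw [h1, Real.exp_add, ← mul_assoc]
  refine mul_le_mul_of_nonneg_right ?_ (Real.exp_pos _).le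
  have h2 : Real.exp (-(y ^ 2)) ≤ 1 := Real.exp_le_one_iff.mpr (by nlinarith [sq_nonneg y])
  have h3 : y ^ 2 * Real.exp (-(y ^ 2)) ≤ 1 := by
    rw [Real.exp_neg, ← div_eq_mul_inv, div_le_one (Real.exp_pos _)]
    linarith [Real.add_one_le_exp (y ^ 2)]
  have h4 : 1 + x ^ 2 ≤ (1 + l ^ 2 / 2) + 2 * y ^ 2 := by
    rw [hy]; nlinarith [sq_nonneg (x - l)]
  calc (1 + x ^ 2) * Real.exp (-(y ^ 2))
      ≤ ((1 + l ^ 2 / 2) + 2 * y ^ 2) * Real.exp (-(y ^ 2)) :=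
        mul_le_mul_of_nonneg_right h4 (Real.exp_pos _).le
    _ = (1 + l ^ 2 / 2) * Real.exp (-(y ^ 2)) + 2 * (y ^ 2 * Real.exp (-(y ^ 2))) := by ring
    _ ≤ (1 + l ^ 2 / 2) * 1 + 2 * 1 := by gcongr
    _ ≤ _ := by nlinarith

/-- The smoothing factor of the heat semigroup against the weight `exp(τ μ A)`: it costs
`τ ^ (-(5/2 - r)/2)` to gain `5/2 - r` derivatives, and `exp(τ μ² / 4)` to absorb the weight. -/
def smoothingFactor (r μ τ : ℝ) : ℝ :=
  τ ^ (r / 2 - 5 / 4) * (1 + μ * √τ) ^ 2 * Real.exp (τ * μ ^ 2 / 4)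

/-- The symbol inequality for the linear evolution of the nonlinear term. Frequencies `|ξ| ≤ 1` are
covered by the first part of `productWeight`. For `k = |2πξ| ≥ 1` and `x = √τ k`, the excess of
`k ^ (1 + r)` over `k ^ (2r - 3/2)` is `k ^ (5/2 - r) = τ ^ (r/2 - 5/4) x ^ (5/2 - r)`, and
`x ^ (5/2 - r) ≤ 1 + x²` is absorbed by `exp(-x²)`. -/
theorem multiplier_le {r : ℝ} (hr0 : 1 / 2 < r) (hr : r < 3 / 2) {μ τ : ℝ} (hμ : 0 ≤ μ)
    (hτ : 0 < τ) (hτ1 : τ ≤ 1) (ξ : E3) :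
    2 * Real.pi * ‖ξ‖ * besselSymbol r ξ *
      (heatFactor τ ξ * Real.exp (τ * (μ * (2 * Real.pi * ‖ξ‖)))) ≤
      400 * smoothingFactor r μ τ * productWeight r ξ := by
  have hpi := Real.pi_gt_three
  have hpi2 := Real.pi_lt_d2
  have hP : (2 * Real.pi) ^ 2 ≤ 40 := by nlinarith
  have hq : (1 : ℝ) ≤ (1 + μ * √τ) ^ 2 :=
    one_le_pow₀ (le_add_of_nonneg_right (by positivity))
  have hτp : 1 ≤ τ ^ (r / 2 - 5 / 4) :=
    Real.one_le_rpow_of_pos_of_le_one_of_nonpos hτ hτ1 (by linarith)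
  have hb0 := (HSob.besselSymbol_pos r ξ).le
  rcases le_or_gt ‖ξ‖ 1 with h | h
  · have h1 : 1 ≤ productWeight r ξ := by
      rw [productWeight, indicator_of_mem (mem_closedBall_zero_iff.mpr h), Pi.one_apply]
      exact le_add_of_nonneg_right (by positivity)
    have h2 : besselSymbol r ξ ≤ 50 := by
      have hle : (2 * Real.pi * ‖ξ‖) ^ 2 ≤ 40 := by
        refine le_trans ?_ hP
        rw [mul_pow]
        exact mul_le_of_le_one_right (by positivity) (pow_le_one₀ (norm_nonneg _) h)
      calc besselSymbol r ξ ≤ (1 + (2 * Real.pi * ‖ξ‖) ^ 2) ^ (1 : ℝ) :=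
            Real.rpow_le_rpow_of_exponent_le (by nlinarith [sq_nonneg (2 * Real.pi * ‖ξ‖)])
              (by linarith)
        _ ≤ 50 := by rw [Real.rpow_one]; linarith
    have h3 : 2 * Real.pi * ‖ξ‖ ≤ 8 := by nlinarith [norm_nonneg ξ]
    have h4 := heatFactor_mul_exp_le hτ.le μ ξ
    have h5 : Real.exp (τ * μ ^ 2 / 4) ≤ smoothingFactor r μ τ := by
      rw [smoothingFactor]
      exact le_mul_of_one_le_left (Real.exp_pos _).le (one_le_mul_of_one_le_of_one_le hτp hq)
    have h6 : 0 ≤ smoothingFactor r μ τ := (Real.exp_pos _).le.trans h5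
    calc _ ≤ 8 * 50 * Real.exp (τ * μ ^ 2 / 4) := by
          have : 0 ≤ heatFactor τ ξ * Real.exp (τ * (μ * (2 * Real.pi * ‖ξ‖))) :=
            mul_nonneg (heatFactor_pos _ _).le (Real.exp_pos _).le
          gcongr
      _ ≤ 400 * smoothingFactor r μ τ * 1 := by linarith
      _ ≤ _ := by gcongr
  · have hρ : 0 < ‖ξ‖ := by linarith
    set k := 2 * Real.pi * ‖ξ‖ with hk
    have hk1 : 1 ≤ k := by rw [hk]; nlinarith
    have hk0 : 0 < k := by linarith
    have h1 : ‖ξ‖ ^ (2 * r - 3 / 2) ≤ productWeight r ξ := by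
      rw [productWeight]
      exact le_add_of_nonneg_left (indicator_nonneg (fun _ _ => zero_le_one) _)
    have h2 : besselSymbol r ξ ≤ 2 * k ^ r := by
      calc besselSymbol r ξ = (1 + k ^ 2) ^ (r / 2) := rfl
        _ ≤ (2 * k ^ 2) ^ (r / 2) :=
            Real.rpow_le_rpow (by positivity) (by nlinarith) (by linarith)
        _ = 2 ^ (r / 2) * k ^ r := by
            rw [Real.mul_rpow zero_le_two (by positivity), ← Real.rpow_natCast,
              ← Real.rpow_mul hk0.le]
            congr 2; push_cast; ring
        _ ≤ 2 ^ (1 : ℝ) * k ^ r := by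
            gcongr
            · norm_num
            · linarith
        _ = 2 * k ^ r := by rw [Real.rpow_one]
    set x := √τ * k with hx
    have hsτ : 0 < √τ := Real.sqrt_pos.mpr hτ
    have hx0 : 0 < x := mul_pos hsτ hk0
    have hss : √τ ^ 2 = τ := Real.sq_sqrt hτ.le
    have h3 : k * k ^ r = k ^ (2 * r - 3 / 2) * (τ ^ (r / 2 - 5 / 4) * x ^ (5 / 2 - r)) := by
      have e1 : x ^ (5 / 2 - r) = τ ^ (5 / 4 - r / 2) * k ^ (5 / 2 - r) := by
        rw [hx, Real.mul_rpow hsτ.le hk0.le, Real.sqrt_eq_rpow, ← Real.rpow_mul hτ.le]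
        congr 2; ring
      have e2 : τ ^ (r / 2 - 5 / 4) * τ ^ (5 / 4 - r / 2) = 1 := by
        rw [← Real.rpow_add hτ]; ring_nf; simp
      have e3 : k * k ^ r = k ^ (2 * r - 3 / 2) * k ^ (5 / 2 - r) := by
        nth_rewrite 1 [← Real.rpow_one k]
        rw [← Real.rpow_add hk0, ← Real.rpow_add hk0]
        congr 1; ring
      rw [e1, e3, ← mul_assoc (τ ^ _), e2, one_mul]
    have h4 : k ^ (2 * r - 3 / 2) ≤ 40 * ‖ξ‖ ^ (2 * r - 3 / 2) := by
      rw [hk, Real.mul_rpow (by positivity) hρ.le]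
      refine mul_le_mul_of_nonneg_right (le_trans ?_ hP) (by positivity)
      rw [← Real.rpow_natCast]
      exact Real.rpow_le_rpow_of_exponent_le (by linarith) (by push_cast; linarith)
    have h5 : x ^ (5 / 2 - r) ≤ 1 + x ^ 2 := by
      rcases le_total x 1 with hx1 | hx1
      · have := Real.rpow_le_one hx0.le hx1 (by linarith : 0 ≤ 5 / 2 - r)
        nlinarith [sq_nonneg x]
      · have : x ^ (5 / 2 - r) ≤ x ^ (2 : ℝ) := Real.rpow_le_rpow_of_exponent_le hx1 (by linarith)
        rw [Real.rpow_two] at this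
        linarith
    have h6 : heatFactor τ ξ * Real.exp (τ * (μ * k)) = Real.exp (μ * √τ * x - x ^ 2) := by
      have e1 : (√τ * k) ^ 2 = τ * k ^ 2 := by rw [mul_pow, hss]
      have e2 : μ * √τ * (√τ * k) = τ * (μ * k) := by
        rw [← hss, Real.sqrt_sq hsτ.le]; ring
      rw [heatFactor, ← Real.exp_add, ← hk, hx, e1, e2]
      congr 1; ring
    have h7 := one_add_sq_mul_exp_le x (μ * √τ) (by positivity)
    rw [mul_pow μ, hss] at h7
    rw [h6]
    calc k * besselSymbol r ξ * Real.exp (μ * √τ * x - x ^ 2)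
        ≤ k * (2 * k ^ r) * Real.exp (μ * √τ * x - x ^ 2) := by gcongr
      _ = 2 * k ^ (2 * r - 3 / 2) * τ ^ (r / 2 - 5 / 4) *
          (x ^ (5 / 2 - r) * Real.exp (μ * √τ * x - x ^ 2)) := by
          rw [show k * (2 * k ^ r) = 2 * (k * k ^ r) by ring, h3]; ring
      _ ≤ 2 * (40 * ‖ξ‖ ^ (2 * r - 3 / 2)) * τ ^ (r / 2 - 5 / 4) *
          ((1 + x ^ 2) * Real.exp (μ * √τ * x - x ^ 2)) := by gcongr
      _ ≤ 2 * (40 * ‖ξ‖ ^ (2 * r - 3 / 2)) * τ ^ (r / 2 - 5 / 4) *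
          (4 * (1 + μ * √τ) ^ 2 * Real.exp (μ ^ 2 * τ / 4)) := by gcongr
      _ = 320 * smoothingFactor r μ τ * ‖ξ‖ ^ (2 * r - 3 / 2) := by
          rw [smoothingFactor, mul_comm τ (μ ^ 2)]; ring
      _ ≤ 400 * smoothingFactor r μ τ * productWeight r ξ := by
          have : 0 ≤ smoothingFactor r μ τ := by rw [smoothingFactor]; positivity
          gcongr
          norm_num

theorem rpow_lintegral_enorm_sq (F : L2) :
    (∫⁻ ξ, ‖F ξ‖ₑ ^ (2 : ℝ)) ^ (1 / 2 : ℝ) = ENNReal.ofReal ‖F‖ := by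
  rw [ofReal_norm, Lp.enorm_def, eLpNorm_eq_lintegral_rpow_enorm_toReal (by norm_num) (by norm_num)]
  norm_num

theorem two_mul_ofReal (x : ℝ) : 2 * ENNReal.ofReal x = ENNReal.ofReal (2 * x) := by
  rw [ENNReal.ofReal_mul zero_le_two]; simp

/-- The weighted estimate for the nonlinear term: the two factors carry the weight at time `s`, the
test function the inverse weight at the later time `t`. -/
theorem exists_nonlinearPairing_bound {r : ℝ} (hr0 : 1 / 2 < r) (hr : r < 3 / 2) :
    ∃ C : ℝ, 0 ≤ C ∧ ∀ {μ R s t Φ : ℝ}, 0 ≤ μ → 0 ≤ R → 0 ≤ s → s < t → t - s ≤ 1 →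
      ∀ {u : HVec r} {D : Fin 3 → Fin 3 → L2}, IsGradient u D → InRangeLeray u →
      ∀ F : Fin 3 → L2, (∀ l, F l =ᵐ[volume] fun ξ =>
        ((gevreyWeight μ R s ξ * besselSymbol r ξ : ℝ) : ℂ) * (𝓕 (u l).toL2 : L2) ξ) →
      (∀ l, ‖F l‖ ≤ Φ) → ∀ (ψ : E3 → ℂ) (Y : L2),
      (Y =ᵐ[volume] fun ξ => (((gevreyWeight μ R t ξ * besselSymbol r ξ)⁻¹ : ℝ) : ℂ) * ψ ξ) →
      ∀ j, ‖nonlinearPairing u D j (fun ξ => (heatFactor (t - s) ξ : ℂ) * ψ ξ)‖ ≤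
        C * smoothingFactor r μ (t - s) * Φ ^ 2 * ‖Y‖ := by
  obtain ⟨C, hCt, hC⟩ := exists_trilinear_bound (by linarith : 0 < r) hr
  refine ⟨2 * (9 * (400 * C.toReal)), by positivity, ?_⟩
  intro μ R s t Φ hμ hR hs hst hτ1 u D hD hu F hF hFΦ ψ Y hY j
  set τ := t - s with hτd
  have hτ : 0 < τ := sub_pos.mpr hst
  set S := smoothingFactor r μ τ with hS
  have hS0 : 0 ≤ S := by rw [hS, smoothingFactor]; positivity
  have hΦ : 0 ≤ Φ := (norm_nonneg _).trans (hFΦ 0)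
  set v : Fin 3 → L2 := fun l => 𝓕 (u l).toL2 with hv
  set I : Fin 3 → Fin 3 → E3 → ℝ≥0∞ := fun l k ξ => ∫⁻ η, ‖v l (ξ - η)‖ₑ * ‖v k η‖ₑ with hI
  have hvm : ∀ l, Measurable fun ξ => ‖v l ξ‖ₑ := fun l => (Lp.stronglyMeasurable (v l)).enorm
  have hFm : ∀ l, Measurable fun ξ => ‖F l ξ‖ₑ := fun l => (Lp.stronglyMeasurable (F l)).enorm
  have hYm : Measurable fun ξ => ‖Y ξ‖ₑ := (Lp.stronglyMeasurable Y).enorm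
  have hbm : Measurable (besselSymbol r) := (continuous_besselSymbol r).measurable
  have hIm : ∀ l k, Measurable (I l k) := fun l k =>
    Measurable.lintegral_prod_right' (f := fun p : E3 × E3 => ‖v l (p.1 - p.2)‖ₑ * ‖v k p.2‖ₑ)
      (((hvm l).comp (measurable_fst.sub measurable_snd)).mul ((hvm k).comp measurable_snd))
  -- pass from the weight at time `t` to the weight at time `s`, then split it between the factors
  have hsym : ∀ ξ η : E3, heatFactor τ ξ * (2 * Real.pi * ‖ξ‖) *
      (gevreyWeight μ R t ξ * besselSymbol r ξ) ≤ 400 * S * productWeight r ξ *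
      (gevreyWeight μ R s (ξ - η) * gevreyWeight μ R s η) := by
    intro ξ η
    have h1 := multiplier_le hr0 hr hμ hτ hτ1 ξ
    have hb0 := (HSob.besselSymbol_pos r ξ).le
    have hh0 := (heatFactor_pos τ ξ).le
    have hg0 := (gevreyWeight_pos μ R s ξ).le
    have hp0 := productWeight_nonneg r ξ
    calc _ ≤ heatFactor τ ξ * (2 * Real.pi * ‖ξ‖) *
        ((Real.exp (τ * (μ * (2 * Real.pi * ‖ξ‖))) * gevreyWeight μ R s ξ) * besselSymbol r ξ) := by
          gcongr
          exact gevreyWeight_le_exp_mul hst.le ξ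
      _ = 2 * Real.pi * ‖ξ‖ * besselSymbol r ξ *
          (heatFactor τ ξ * Real.exp (τ * (μ * (2 * Real.pi * ‖ξ‖)))) * gevreyWeight μ R s ξ := by
          ring
      _ ≤ 400 * S * productWeight r ξ * gevreyWeight μ R s ξ := by gcongr
      _ ≤ _ := by
          gcongr
          exact gevreyWeight_le_mul hμ hR hs ξ η
  have hpair : ∀ l k, ∫⁻ ξ, ‖(heatFactor τ ξ : ℂ) * ψ ξ‖ₑ *
      (ENNReal.ofReal (2 * Real.pi * ‖ξ‖) * I l k ξ) ≤
      ENNReal.ofReal (400 * S * C.toReal * Φ ^ 2 * ‖Y‖) := by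
    intro l k
    calc _ ≤ ∫⁻ ξ, ∫⁻ η, ENNReal.ofReal (400 * S) * ‖Y ξ‖ₑ * (ENNReal.ofReal (productWeight r ξ) *
        (ENNReal.ofReal (besselSymbol r (ξ - η))⁻¹ * ‖F l (ξ - η)‖ₑ) *
        (ENNReal.ofReal (besselSymbol r η)⁻¹ * ‖F k η‖ₑ)) := by
          refine lintegral_mono_ae ?_
          filter_upwards [hY] with ξ hξ
          rw [hI]
          simp only
          have hvv : Measurable fun η => ‖v l (ξ - η)‖ₑ * ‖v k η‖ₑ :=
            ((hvm l).comp (measurable_const.sub measurable_id)).mul (hvm k)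
          rw [← mul_assoc, ← lintegral_const_mul _ hvv]
          have hq := (Measure.measurePreserving_sub_left (volume : Measure E3)
            ξ).quasiMeasurePreserving.ae (hF l)
          refine lintegral_mono_ae ?_
          filter_upwards [hq, hF k] with η h1 h2
          have hw1 := gevreyWeight_pos μ R s (ξ - η)
          have hw2 := gevreyWeight_pos μ R s η
          have hw3 := gevreyWeight_pos μ R t ξ
          have hb1 := HSob.besselSymbol_pos r (ξ - η)
          have hb2 := HSob.besselSymbol_pos r η
          have hb3 := HSob.besselSymbol_pos r ξ
          have hp0 := productWeight_nonneg r ξ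
          simp only [← ofReal_norm]
          rw [← ENNReal.ofReal_mul (by positivity), ← ENNReal.ofReal_mul (by positivity),
            ← ENNReal.ofReal_mul (by positivity), ← ENNReal.ofReal_mul (by positivity),
            ← ENNReal.ofReal_mul (by positivity), ← ENNReal.ofReal_mul (by positivity),
            ← ENNReal.ofReal_mul (by positivity), ← ENNReal.ofReal_mul (by positivity),
            ← ENNReal.ofReal_mul (by positivity)]
          apply ENNReal.ofReal_le_ofReal
          rw [h1, h2, hξ]
          simp only [norm_mul, Complex.norm_real, Real.norm_eq_abs, abs_of_pos (heatFactor_pos τ ξ),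
            abs_of_pos hw1, abs_of_pos hb1, abs_of_pos hw2, abs_of_pos hb2,
            abs_of_pos (inv_pos.mpr (mul_pos hw3 hb3))]
          have h3 := mul_le_mul_of_nonneg_left (hsym ξ η) (by positivity :
            0 ≤ (gevreyWeight μ R t ξ * besselSymbol r ξ)⁻¹ * ‖ψ ξ‖ * ‖v l (ξ - η)‖ * ‖v k η‖)
          refine le_trans (le_of_eq ?_) (h3.trans (le_of_eq ?_))
          · field_simp
          · simp only [hv]
            field_simp
      _ = ENNReal.ofReal (400 * S) * ∫⁻ ξ, ∫⁻ η, ‖Y ξ‖ₑ * (ENNReal.ofReal (productWeight r ξ) *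
        (ENNReal.ofReal (besselSymbol r (ξ - η))⁻¹ * ‖F l (ξ - η)‖ₑ) *
        (ENNReal.ofReal (besselSymbol r η)⁻¹ * ‖F k η‖ₑ)) := by
          simp_rw [mul_assoc (ENNReal.ofReal (400 * S)),
            lintegral_const_mul' (ENNReal.ofReal (400 * S)) _ ENNReal.ofReal_ne_top]
      _ ≤ ENNReal.ofReal (400 * S) * (C * ((∫⁻ ξ, ‖Y ξ‖ₑ ^ (2 : ℝ)) ^ (1 / 2 : ℝ) *
          (∫⁻ ξ, ‖F l ξ‖ₑ ^ (2 : ℝ)) ^ (1 / 2 : ℝ) * (∫⁻ ξ, ‖F k ξ‖ₑ ^ (2 : ℝ)) ^ (1 / 2 : ℝ))) := by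
          gcongr
          exact hC _ _ _ hYm (hFm l) (hFm k)
      _ = ENNReal.ofReal (400 * S * C.toReal * ‖F l‖ * ‖F k‖ * ‖Y‖) := by
          rw [rpow_lintegral_enorm_sq, rpow_lintegral_enorm_sq, rpow_lintegral_enorm_sq,
            ← ENNReal.ofReal_toReal hCt, ← ENNReal.ofReal_mul (by positivity),
            ← ENNReal.ofReal_mul (by positivity), ← ENNReal.ofReal_mul (by positivity),
            ← ENNReal.ofReal_mul (by positivity), ENNReal.toReal_ofReal (by positivity)]
          congr 1; ring
      _ ≤ _ := by
          apply ENNReal.ofReal_le_ofReal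
          rw [sq, ← mul_assoc]
          gcongr
          · exact hFΦ l
          · exact hFΦ k
  have hler : ∀ ξ, ‖leray ξ (fun k => 𝓕 (convection u D k) ξ) j * ((heatFactor τ ξ : ℂ) * ψ ξ)‖ₑ ≤
      ∑ k, ∑ l, 2 * (‖(heatFactor τ ξ : ℂ) * ψ ξ‖ₑ *
        (ENNReal.ofReal (2 * Real.pi * ‖ξ‖) * I l k ξ)) := by
    intro ξ
    have h1 : ‖leray ξ (fun k => 𝓕 (convection u D k) ξ) j‖ₑ ≤
        2 * ∑ k, ‖𝓕 (convection u D k) ξ‖ₑ := by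
      simp only [← ofReal_norm]
      rw [← ENNReal.ofReal_sum_of_nonneg fun _ _ => norm_nonneg _, two_mul_ofReal]
      exact ENNReal.ofReal_le_ofReal (norm_leray_le ξ _ j)
    rw [enorm_mul]
    calc _ ≤ (2 * ∑ k, (ENNReal.ofReal (2 * Real.pi * ‖ξ‖) * ∑ l, I l k ξ)) *
        ‖(heatFactor τ ξ : ℂ) * ψ ξ‖ₑ := by
          refine mul_le_mul_left (h1.trans ?_) _
          gcongr with k
          exact enorm_fourier_convection_le hD hu k ξ
      _ = _ := by
          simp only [Finset.mul_sum, Finset.sum_mul]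
          refine Finset.sum_congr rfl fun k _ => Finset.sum_congr rfl fun l _ => ?_
          ring
  have hψm : AEMeasurable (fun ξ => ‖(heatFactor τ ξ : ℂ) * ψ ξ‖ₑ) volume := by
    have hm : Measurable fun ξ => (heatFactor τ ξ : ℂ) *
        (((gevreyWeight μ R t ξ * besselSymbol r ξ : ℝ) : ℂ) * Y ξ) :=
      (Complex.measurable_ofReal.comp (contDiff_heatFactor τ).continuous.measurable).mul
        ((Complex.measurable_ofReal.comp ((continuous_gevreyWeight μ R t).measurable.mul hbm)).mul
          (Lp.stronglyMeasurable Y).measurable)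
    refine AEMeasurable.enorm ⟨_, hm, ?_⟩
    filter_upwards [hY] with ξ hξ
    have h1 : gevreyWeight μ R t ξ * besselSymbol r ξ ≠ 0 :=
      (mul_pos (gevreyWeight_pos μ R t ξ) (HSob.besselSymbol_pos r ξ)).ne'
    rw [hξ, ← mul_assoc (_ : ℂ) (_ : ℂ) (ψ ξ), ← Complex.ofReal_mul, mul_inv_cancel₀ h1,
      Complex.ofReal_one, one_mul]
  have hfin : ‖nonlinearPairing u D j (fun ξ => (heatFactor τ ξ : ℂ) * ψ ξ)‖ₑ ≤
      ENNReal.ofReal (2 * (9 * (400 * C.toReal)) * S * Φ ^ 2 * ‖Y‖) := by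
    calc _ ≤ ∫⁻ ξ, ∑ k, ∑ l, 2 * (‖(heatFactor τ ξ : ℂ) * ψ ξ‖ₑ *
        (ENNReal.ofReal (2 * Real.pi * ‖ξ‖) * I l k ξ)) :=
          (enorm_integral_le_lintegral_enorm _).trans (lintegral_mono hler)
      _ = ∑ k, ∑ l, 2 * ∫⁻ ξ, (‖(heatFactor τ ξ : ℂ) * ψ ξ‖ₑ *
        (ENNReal.ofReal (2 * Real.pi * ‖ξ‖) * I l k ξ)) := by
          have hm : ∀ l k, AEMeasurable (fun ξ => 2 * (‖(heatFactor τ ξ : ℂ) * ψ ξ‖ₑ *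
              (ENNReal.ofReal (2 * Real.pi * ‖ξ‖) * I l k ξ))) volume := fun l k =>
            (hψm.mul ((Measurable.mul (by fun_prop) (hIm l k)).aemeasurable)).const_mul 2
          rw [lintegral_finsetSum' _ fun k _ => Finset.aemeasurable_fun_sum _ fun l _ => hm l k]
          refine Finset.sum_congr rfl fun k _ => ?_
          rw [lintegral_finsetSum' _ fun l _ => hm l k]
          exact Finset.sum_congr rfl fun l _ => lintegral_const_mul' _ _ (by norm_num)
      _ ≤ ∑ _k : Fin 3, ∑ _l : Fin 3, 2 * ENNReal.ofReal (400 * S * C.toReal * Φ ^ 2 * ‖Y‖) := by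
          gcongr with k _ l _
          exact hpair l k
      _ = _ := by
          simp only [Finset.sum_const, Finset.card_univ, Fintype.card_fin]
          rw [two_mul_ofReal, ← ENNReal.ofReal_nsmul, ← ENNReal.ofReal_nsmul]
          congr 1; simp only [nsmul_eq_mul]; push_cast; ring
  rw [← ofReal_norm] at hfin
  exact (ENNReal.ofReal_le_ofReal_iff (by positivity)).mp hfin

/-! ### Duality and the a priori estimate -/

theorem norm_pairing_le (f g : L2) : ‖pairing f g‖ ≤ ‖f‖ * ‖g‖ := by
  have h1 : pairing f g = inner ℂ (star f) g := by
    rw [pairing_apply, L2.inner_def]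
    refine integral_congr_ae ?_
    filter_upwards [Lp.coeFn_star f] with x hx
    rw [hx]
    simp [RCLike.inner_apply, mul_comm]
  have h2 : ‖star f‖ ≤ ‖f‖ := by
    refine Lp.norm_le_norm_of_ae_le ?_
    filter_upwards [Lp.coeFn_star f] with x hx
    rw [hx]; simp
  rw [h1]
  exact (norm_inner_le_norm _ _).trans (mul_le_mul_of_nonneg_right h2 (norm_nonneg _))

/-- Fatou's lemma for the `L²` norm. -/
theorem eLpNorm_le_of_tendsto {f : ℕ → E3 → ℂ} {g : E3 → ℂ} {M : ℝ≥0∞}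
    (hf : ∀ n, AEStronglyMeasurable (f n) volume)
    (hlim : ∀ᵐ x : E3, Tendsto (fun n => f n x) atTop (𝓝 (g x)))
    (hM : ∀ n, eLpNorm (f n) 2 volume ≤ M) : eLpNorm g 2 volume ≤ M :=
  (Lp.eLpNorm_lim_le_liminf_eLpNorm hf g hlim).trans
    (liminf_le_of_frequently_le' (Frequently.of_forall hM))

/-- A weighted `L²` bound follows from its dual form, tested against smooth compactly supported
functions only. -/
theorem norm_le_of_forall_test {f X : L2} {W : E3 → ℝ} (hWc : Continuous W) (hW1 : ∀ ξ, 1 ≤ W ξ)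
    (hX : X =ᵐ[volume] fun ξ => (W ξ : ℂ) * f ξ) {M : ℝ} (hM : 0 ≤ M)
    (h : ∀ ψ : E3 → ℂ, HasCompactSupport ψ → ContDiff ℝ (⊤ : ℕ∞) ψ → ∀ Y : L2,
      (Y =ᵐ[volume] fun ξ => (((W ξ)⁻¹ : ℝ) : ℂ) * ψ ξ) → ‖∫ ξ, ψ ξ * f ξ‖ ≤ M * ‖Y‖) :
    ‖X‖ ≤ M := by
  have hW0 : ∀ ξ, 0 < W ξ := fun ξ => one_pos.trans_le (hW1 ξ)
  have hWi : ∀ ξ, |(W ξ)⁻¹| ≤ 1 := fun ξ => by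
    rw [abs_of_pos (inv_pos.mpr (hW0 ξ))]
    exact inv_le_one_of_one_le₀ (hW1 ξ)
  have hmem : ∀ g : L2, MemLp (fun ξ => (((W ξ)⁻¹ : ℝ) : ℂ) * g ξ) 2 volume := fun g => by
    refine (Lp.memLp g).of_le ?_ (ae_of_all _ fun ξ => ?_)
    · exact (Complex.continuous_ofReal.comp (hWc.inv₀ fun ξ => (hW0 ξ).ne')).aestronglyMeasurable.mul
        (Lp.memLp g).1
    · rw [norm_mul, Complex.norm_real, Real.norm_eq_abs]
      exact mul_le_of_le_one_left (norm_nonneg _) (hWi ξ)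
  -- by density the hypothesis extends to all test functions in `L²`
  have key : ∀ g Y : L2, (Y =ᵐ[volume] fun ξ => (((W ξ)⁻¹ : ℝ) : ℂ) * g ξ) →
      ‖pairing g f‖ ≤ M * ‖Y‖ := by
    intro g Y hY
    obtain ⟨G, hG, hGl⟩ := mem_closure_iff_seq_limit.mp
      ((Lp.dense_hasCompactSupport_contDiff (F := ℂ) (E := E3) (μ := volume)
        (p := 2) ENNReal.ofNat_ne_top) g)
    have hb : ∀ n, ‖pairing (G n) f‖ ≤ M * (‖Y‖ + ‖G n - g‖) := by
      intro n
      obtain ⟨ψ, hψ, hs, hc⟩ := hG n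
      have hZ := (hmem (G n)).coeFn_toLp
      have h1 := h ψ hs hc ((hmem (G n)).toLp _) (by
        filter_upwards [hZ, hψ] with ξ h2 h3
        rw [h2, h3])
      have h2 : pairing (G n) f = ∫ ξ, ψ ξ * f ξ := by
        rw [pairing_apply]
        refine integral_congr_ae ?_
        filter_upwards [hψ] with ξ h3
        rw [h3]
      rw [h2]
      refine h1.trans (mul_le_mul_of_nonneg_left ?_ hM)
      have h3 : ‖(hmem (G n)).toLp _ - Y‖ ≤ ‖G n - g‖ := by
        refine Lp.norm_le_norm_of_ae_le ?_
        filter_upwards [hZ, hY, Lp.coeFn_sub ((hmem (G n)).toLp _) Y, Lp.coeFn_sub (G n) g]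
          with ξ a1 a2 a3 a4
        rw [a3, a4, Pi.sub_apply, Pi.sub_apply, a1, a2, ← mul_sub, norm_mul, Complex.norm_real,
          Real.norm_eq_abs]
        exact mul_le_of_le_one_left (norm_nonneg _) (hWi ξ)
      calc ‖(hmem (G n)).toLp _‖ = ‖Y + ((hmem (G n)).toLp _ - Y)‖ := by rw [add_sub_cancel]
        _ ≤ _ := (norm_add_le _ _).trans (add_le_add_right h3 _)
    have hl1 : Tendsto (fun n => ‖pairing (G n) f‖) atTop (𝓝 ‖pairing g f‖) := by
      have hc : Continuous fun a : L2 => ‖pairing a f‖ := by fun_prop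
      exact (hc.tendsto g).comp hGl
    have hl2 : Tendsto (fun n => M * (‖Y‖ + ‖G n - g‖)) atTop (𝓝 (M * (‖Y‖ + ‖g - g‖))) := by
      have hc : Continuous fun a : L2 => M * (‖Y‖ + ‖a - g‖) := by fun_prop
      exact (hc.tendsto g).comp hGl
    have := le_of_tendsto_of_tendsto' hl1 hl2 hb
    simpa using this
  -- test with `conj(X) W` restricted to the set where `W ≤ n`
  set s : ℕ → Set E3 := fun n => {ξ | W ξ ≤ n} with hs
  have hsm : ∀ n, MeasurableSet (s n) := fun n => (isClosed_le hWc continuous_const).measurableSet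
  have hXs : ∀ n, MemLp ((s n).indicator fun ξ => (starRingEnd ℂ) (X ξ)) 2 volume := fun n =>
    MemLp.indicator (hsm n) ((Lp.memLp X).of_le
      (Complex.continuous_conj.comp_aestronglyMeasurable (Lp.memLp X).1)
      (ae_of_all _ fun ξ => by simp))
  have hgs : ∀ n, MemLp (fun ξ => (W ξ : ℂ) * (s n).indicator
      (fun ξ => (starRingEnd ℂ) (X ξ)) ξ) 2 volume := fun n => by
    refine ((hXs n).const_mul (n : ℂ)).of_le ((Complex.continuous_ofReal.comp
      hWc).aestronglyMeasurable.mul (hXs n).1) (ae_of_all _ fun ξ => ?_)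
    by_cases hξ : ξ ∈ s n
    · rw [indicator_of_mem hξ, norm_mul, norm_mul, Complex.norm_real, Real.norm_of_nonneg (hW0 ξ).le,
        Complex.norm_natCast]
      exact mul_le_mul_of_nonneg_right hξ (norm_nonneg _)
    · rw [indicator_of_notMem hξ]; simp
  have hn : ∀ n, ‖(hXs n).toLp _‖ ≤ M := by
    intro n
    set Y : L2 := (hXs n).toLp _ with hYd
    set g : L2 := (hgs n).toLp _ with hgd
    have h1 : (Y =ᵐ[volume] fun ξ => (((W ξ)⁻¹ : ℝ) : ℂ) * g ξ) := by
      filter_upwards [(hXs n).coeFn_toLp, (hgs n).coeFn_toLp] with ξ a1 a2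
      rw [a1, a2, ← mul_assoc, ← Complex.ofReal_mul, inv_mul_cancel₀ (hW0 ξ).ne',
        Complex.ofReal_one, one_mul]
    have h2 : pairing g f = inner ℂ Y Y := by
      rw [pairing_apply, L2.inner_def]
      refine integral_congr_ae ?_
      filter_upwards [(hXs n).coeFn_toLp, (hgs n).coeFn_toLp, hX] with ξ a1 a2 a3
      rw [a1, a2, RCLike.inner_apply]
      by_cases hξ : ξ ∈ s n
      · rw [indicator_of_mem hξ, Complex.conj_conj, mul_right_comm, ← a3, mul_comm]
      · rw [indicator_of_notMem hξ]; simp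
    have h3 := key g Y h1
    rw [h2, inner_self_eq_norm_sq_to_K] at h3
    have h4 : ‖Y‖ ^ 2 ≤ M * ‖Y‖ := by simpa using h3
    rcases eq_or_lt_of_le (norm_nonneg Y) with h5 | h5
    · rw [← h5]; exact hM
    · rw [sq] at h4
      exact le_of_mul_le_mul_right h4 h5
  have hlim := eLpNorm_le_of_tendsto (f := fun n => (s n).indicator fun ξ => (starRingEnd ℂ) (X ξ))
    (g := fun ξ => (starRingEnd ℂ) (X ξ)) (M := ENNReal.ofReal M) (fun n => (hXs n).1)
    (ae_of_all _ fun ξ => by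
      obtain ⟨N, hN⟩ := exists_nat_ge (W ξ)
      refine tendsto_const_nhds.congr' ?_
      filter_upwards [eventually_ge_atTop N] with n hn'
      have : ξ ∈ s n := hN.trans (by exact_mod_cast hn')
      rw [indicator_of_mem this])
    (fun n => by
      have := hn n
      rw [Lp.norm_toLp] at this
      exact ENNReal.le_ofReal_iff_toReal_le (hXs n).eLpNorm_ne_top hM |>.mpr this)
  rw [Lp.norm_def]
  refine ENNReal.toReal_le_of_le_ofReal hM (le_trans (le_of_eq ?_) hlim)
  refine eLpNorm_congr_norm_ae (ae_of_all _ fun ξ => by simp)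

theorem continuousOn_heatTest_pairing {ψ : E3 → ℂ} (hs : HasCompactSupport ψ)
    (hc : ContDiff ℝ (⊤ : ℕ∞) ψ) (t : ℝ) {U : ℝ → L2} {S : Set ℝ} (hU : ContinuousOn U S) :
    ContinuousOn (fun σ => ∫ ξ, heatTest hs hc (t - σ) ξ * U σ ξ) S := by
  have hΨ : Continuous (fun σ => ((heatTest hs hc (t - σ)).toLp 2 volume : L2)) :=
    continuous_iff_continuousAt.mpr fun σ => (hasDerivAt_heatTest hs hc t σ).continuousAt
  have h2 : ContinuousOn (fun σ => pairing ((heatTest hs hc (t - σ)).toLp 2 volume) (U σ)) S :=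
    (pairing.continuous.comp hΨ).continuousOn.clm_apply hU
  simpa only [pairing_heatTest] using h2

/-- The heat semigroup at time `t` absorbs the weight `exp(t μ A)`. -/
theorem norm_heatTest_pairing_le {ψ : E3 → ℂ} (hs : HasCompactSupport ψ)
    (hc : ContDiff ℝ (⊤ : ℕ∞) ψ) {r μ R t : ℝ} (ht : 0 ≤ t) {f F Y : L2}
    (hY : Y =ᵐ[volume] fun ξ => (((gevreyWeight μ R t ξ * besselSymbol r ξ)⁻¹ : ℝ) : ℂ) * ψ ξ)
    (hF : F =ᵐ[volume] fun ξ =>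
      ((gevreyWeight μ R 0 ξ * besselSymbol r ξ : ℝ) : ℂ) * f ξ) :
    ‖∫ ξ, heatTest hs hc t ξ * f ξ‖ ≤ Real.exp (t * μ ^ 2 / 4) * ‖Y‖ * ‖F‖ := by
  set E := Real.exp (t * μ ^ 2 / 4) with hE
  have hE0 : 0 < E := Real.exp_pos _
  have hZ : MemLp (fun ξ => ((heatFactor t ξ * gevreyWeight μ R t ξ : ℝ) : ℂ) * Y ξ) 2 volume ∧
      ∀ ξ, ‖((heatFactor t ξ * gevreyWeight μ R t ξ : ℝ) : ℂ) * Y ξ‖ ≤ E * ‖Y ξ‖ := by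
    have hle : ∀ ξ, ‖((heatFactor t ξ * gevreyWeight μ R t ξ : ℝ) : ℂ) * Y ξ‖ ≤ E * ‖Y ξ‖ := by
      intro ξ
      have h0 := heatFactor_pos t ξ
      rw [norm_mul, Complex.norm_real, Real.norm_of_nonneg
        (mul_pos h0 (gevreyWeight_pos μ R t ξ)).le]
      refine mul_le_mul_of_nonneg_right (le_trans ?_ (heatFactor_mul_exp_le ht μ ξ))
        (norm_nonneg _)
      refine mul_le_mul_of_nonneg_left ?_ h0.le
      exact Real.exp_le_exp.mpr (mul_le_mul_of_nonneg_left (min_le_left _ _) ht)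
    refine ⟨((Lp.memLp Y).const_mul (E : ℂ)).of_le ?_ (ae_of_all _ fun ξ => ?_), hle⟩
    · exact (Complex.continuous_ofReal.comp ((contDiff_heatFactor t).continuous.mul
        (continuous_gevreyWeight μ R t))).aestronglyMeasurable.mul (Lp.memLp Y).1
    · rw [norm_mul (E : ℂ), Complex.norm_real, Real.norm_of_nonneg hE0.le]
      exact hle ξ
  have h1 : (∫ ξ, heatTest hs hc t ξ * f ξ) = pairing (hZ.1.toLp _) F := by
    rw [pairing_apply]
    refine integral_congr_ae ?_
    filter_upwards [hZ.1.coeFn_toLp, hF, hY] with ξ a1 a2 a3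
    have hb := (HSob.besselSymbol_pos r ξ).ne'
    have hg := (gevreyWeight_pos μ R t ξ).ne'
    have h0 : gevreyWeight μ R 0 ξ = 1 := by simp [gevreyWeight]
    rw [a1, a2, a3, heatTest_apply, h0]
    push_cast
    have hb' : (besselSymbol r ξ : ℂ) ≠ 0 := by exact_mod_cast hb
    have hg' : (gevreyWeight μ R t ξ : ℂ) ≠ 0 := by exact_mod_cast hg
    field_simp
  have h2 : ‖hZ.1.toLp _‖ ≤ E * ‖Y‖ := by
    refine Lp.norm_le_mul_norm_of_ae_le_mul ?_
    filter_upwards [hZ.1.coeFn_toLp] with ξ a1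
    rw [a1]
    exact hZ.2 ξ
  rw [h1]
  exact (norm_pairing_le _ _).trans (mul_le_mul_of_nonneg_right h2 (norm_nonneg _))

/-- The a priori estimate at time `t`, given a bound at all earlier times. The time integral of the
smoothing factor is evaluated by comparison with the explicit antiderivative
`-(t - σ) ^ ((2r-1)/4)`. -/
theorem exists_apriori_bound {r : ℝ} (hr0 : 1 / 2 < r) (hr : r < 3 / 2) :
    ∃ C : ℝ, 0 ≤ C ∧ ∀ {T : ℝ} {u : ℝ → HVec r}, IsStrongSolution r T u →
      ∀ {μ R t L : ℝ}, 0 ≤ μ → 0 ≤ R → 0 < t → t ≤ 1 → t ≤ T → 0 ≤ L →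
      ∀ F : ℝ → Fin 3 → L2, (∀ s ∈ Icc 0 t, ∀ l, F s l =ᵐ[volume] fun ξ =>
        ((gevreyWeight μ R s ξ * besselSymbol r ξ : ℝ) : ℂ) * (𝓕 (u s l).toL2 : L2) ξ) →
      (∀ j, ContinuousOn (fun s => (𝓕 (u s j).toL2 : L2)) (Icc 0 T)) →
      (∀ s ∈ Ioo 0 t, ∀ l, ‖F s l‖ ≤ L * Real.exp (s * μ ^ 2 / 4)) →
      ∀ j, ‖F t j‖ ≤ Real.exp (t * μ ^ 2 / 4) * (‖F 0 j‖ +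
        C * (1 + μ * √t) ^ 2 * Real.exp (t * μ ^ 2 / 4) * t ^ (r / 2 - 1 / 4) * L ^ 2) := by
  obtain ⟨C, hC0, hC⟩ := exists_nonlinearPairing_bound hr0 hr
  set γ := r / 2 - 1 / 4 with hγ
  have hγ0 : 0 < γ := by rw [hγ]; linarith
  refine ⟨C / γ, by positivity, ?_⟩
  intro T u hu μ R t L hμ hR ht ht1 htT hL F hF hUc hFL j
  obtain ⟨D, hD, heq⟩ := hu.equation
  set W : E3 → ℝ := fun ξ => gevreyWeight μ R t ξ * besselSymbol r ξ with hW
  have hr0' : 0 ≤ r := by linarith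
  refine norm_le_of_forall_test (f := 𝓕 (u t j).toL2) (W := W)
    ((continuous_gevreyWeight μ R t).mul (continuous_besselSymbol r))
    (fun ξ => one_le_mul_of_one_le_of_one_le (one_le_gevreyWeight hμ hR ht.le ξ)
      (one_le_besselSymbol hr0' ξ)) (hF t (right_mem_Icc.mpr ht.le) j) (by positivity) ?_
  intro ψ hs hc Y hY
  set U : ℝ → L2 := fun s => 𝓕 (u s j).toL2 with hU
  set h : ℝ → ℂ := fun σ => ∫ ξ, heatTest hs hc (t - σ) ξ * U σ ξ with hh
  have hIcc : Icc 0 t ⊆ Icc 0 T := Icc_subset_Icc_right htT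
  have hcont : ContinuousOn h (Icc 0 t) :=
    continuousOn_heatTest_pairing hs hc t ((hUc j).mono hIcc)
  have hderiv : ∀ σ ∈ Ioo 0 t, HasDerivWithinAt h
      (-nonlinearPairing (u σ) (D σ) j (fun ξ => (heatFactor (t - σ) ξ : ℂ) * ψ ξ)) (Ici σ) σ := by
    intro σ hσ
    have hσT : σ ∈ Ioc 0 T := ⟨hσ.1, hσ.2.le.trans htT⟩
    have h1 := hasDerivWithinAt_pairing_heatTest hs hc (t := t) (S := Ioc 0 T)
      (((hUc j) σ (Ioc_subset_Icc_self hσT)).mono Ioc_subset_Icc_self)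
      (hasDerivWithinAt_fourier_pairing (heatTest hs hc (t - σ)) ((heq j _).1 σ hσT))
    refine h1.mono_of_mem_nhdsWithin ?_
    exact mem_of_superset (Icc_mem_nhdsGE (hσ.2.trans_le htT)) fun x hx => ⟨hσ.1.trans_le hx.1, hx.2⟩
  set E := Real.exp (t * μ ^ 2 / 4) with hE
  have hE0 : 0 < E := Real.exp_pos _
  set c := C * (1 + μ * √t) ^ 2 * (E * E) * L ^ 2 * ‖Y‖ with hcdef
  have hc0 : 0 ≤ c := by positivity
  have hbound : ∀ σ ∈ Ioo 0 t, ‖-nonlinearPairing (u σ) (D σ) j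
      (fun ξ => (heatFactor (t - σ) ξ : ℂ) * ψ ξ)‖ ≤ c * (t - σ) ^ (γ - 1) := by
    intro σ hσ
    have hσT : σ ∈ Ioc 0 T := ⟨hσ.1, hσ.2.le.trans htT⟩
    have hτ : 0 < t - σ := sub_pos.mpr hσ.2
    rw [norm_neg]
    refine (hC hμ hR hσ.1.le hσ.2 (by linarith [hσ.1]) (hD σ hσT)
      (hu.inRange σ (Ioc_subset_Icc_self hσT)) (F σ) (hF σ ⟨hσ.1.le, hσ.2.le⟩) (hFL σ hσ) ψ Y hY
      j).trans ?_
    -- the exponents add up to `(t + σ) μ² / 4`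
    have e1 : Real.exp ((t - σ) * μ ^ 2 / 4) * Real.exp (σ * μ ^ 2 / 4) ^ 2 ≤ E * E := by
      rw [hE, sq (Real.exp _), ← Real.exp_add, ← Real.exp_add, ← Real.exp_add]
      refine Real.exp_le_exp.mpr ?_
      nlinarith [mul_nonneg hτ.le (sq_nonneg μ)]
    have e2 : √(t - σ) ≤ √t := Real.sqrt_le_sqrt (by linarith [hσ.1])
    have e3 : γ - 1 = r / 2 - 5 / 4 := by rw [hγ]; ring
    rw [smoothingFactor, e3]
    calc _ = C * (1 + μ * √(t - σ)) ^ 2 * (Real.exp ((t - σ) * μ ^ 2 / 4) *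
          Real.exp (σ * μ ^ 2 / 4) ^ 2) * L ^ 2 * ‖Y‖ * (t - σ) ^ (r / 2 - 5 / 4) := by ring
      _ ≤ _ := by rw [hcdef]; gcongr
  -- the equation holds for positive times only, so start at `δ > 0` and let `δ → 0`
  have hδ : ∀ δ ∈ Ioo 0 t, ‖h t‖ ≤ ‖h δ‖ + c / γ * (t - δ) ^ γ := by
    intro δ hδ
    have hsub : ∀ x ∈ Ico δ t, x ∈ Ioo 0 t := fun x hx => ⟨hδ.1.trans_le hx.1, hx.2⟩
    have := image_norm_le_of_norm_deriv_right_le_deriv_boundary' (a := δ) (b := t)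
      (f := h) (B := fun σ => ‖h δ‖ + c / γ * ((t - δ) ^ γ - (t - σ) ^ γ))
      (B' := fun σ => c * (t - σ) ^ (γ - 1))
      (hcont.mono (Icc_subset_Icc_left hδ.1.le)) (fun x hx => hderiv x (hsub x hx)) (by simp)
      (by
        refine ContinuousOn.add continuousOn_const (continuousOn_const.mul
          (continuousOn_const.sub ?_))
        exact (continuous_const.sub continuous_id).continuousOn.rpow_const
          fun x _ => Or.inr hγ0.le)
      (fun x hx => by
        have hx0 : t - x ≠ 0 := (sub_pos.mpr hx.2).ne'
        have h1 : HasDerivAt (fun σ => (t - σ) ^ γ) (-1 * γ * (t - x) ^ (γ - 1)) x :=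
          ((hasDerivAt_id x).const_sub t).rpow_const (Or.inl hx0)
        have h2 := ((h1.const_sub ((t - δ) ^ γ)).const_mul (c / γ)).const_add ‖h δ‖
        refine (h2.congr_deriv ?_).hasDerivWithinAt
        field_simp)
      (fun x hx => hbound x (hsub x hx)) (right_mem_Icc.mpr hδ.2.le)
    simpa [Real.zero_rpow hγ0.ne'] using this
  have hlim : ‖h t‖ ≤ ‖h 0‖ + c / γ * (t - 0) ^ γ := by
    have h1 : Tendsto (fun δ => ‖h δ‖ + c / γ * (t - δ) ^ γ) (𝓝[Ioo 0 t] 0)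
        (𝓝 (‖h 0‖ + c / γ * (t - 0) ^ γ)) := by
      refine Tendsto.add ?_ ?_
      · exact ((hcont 0 (left_mem_Icc.mpr ht.le)).tendsto.mono_left
          (nhdsWithin_mono _ Ioo_subset_Icc_self)).norm
      · refine Tendsto.const_mul _ (Continuous.tendsto' ?_ _ _ rfl |>.mono_left nhdsWithin_le_nhds)
        exact (continuous_const.sub continuous_id).rpow_const fun x => Or.inr hγ0.le
    have : (𝓝[Ioo 0 t] (0 : ℝ)).NeBot := left_nhdsWithin_Ioo_neBot ht
    exact ge_of_tendsto h1 (eventually_nhdsWithin_of_forall hδ)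
  have hzero : ‖h 0‖ ≤ E * ‖Y‖ * ‖F 0 j‖ := by
    have := norm_heatTest_pairing_le hs hc ht.le hY (hF 0 (left_mem_Icc.mpr ht.le) j)
    simpa only [hh, sub_zero] using this
  have hfin : (∫ ξ, ψ ξ * (𝓕 (u t j).toL2 : L2) ξ) = h t := by
    simp [hh, heatTest_apply, heatFactor, hU]
  rw [hfin]
  refine hlim.trans ((add_le_add_left hzero _).trans (le_of_eq ?_))
  rw [hcdef, sub_zero]
  ring

/-! ### Bootstrap and removal of the truncation -/

theorem coeFn_weightedFourier {r : ℝ} (f : HSob r) :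
    HSob.weightedFourier f =ᵐ[volume] fun ξ => (besselSymbol r ξ : ℂ) * (𝓕 f.toL2 : L2) ξ :=
  f.memLp.coeFn_toLp

theorem HSob.norm_def {r : ℝ} (f : HSob r) : ‖f‖ = ‖HSob.weightedFourier f‖ := rfl

theorem HSob.norm_toL2_le {r : ℝ} (hr : 0 ≤ r) (f : HSob r) : ‖f.toL2‖ ≤ ‖f‖ := by
  rw [← Lp.norm_fourier_eq, HSob.norm_def]
  refine Lp.norm_le_norm_of_ae_le ?_
  filter_upwards [coeFn_weightedFourier f] with ξ hξ
  rw [hξ, norm_mul, Complex.norm_real, Real.norm_of_nonneg (HSob.besselSymbol_pos r ξ).le]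
  exact le_mul_of_one_le_left (norm_nonneg _) (one_le_besselSymbol hr ξ)

theorem HSob.continuous_toL2 {r : ℝ} (hr : 0 ≤ r) : Continuous (HSob.toL2 (r := r)) :=
  AddMonoidHomClass.continuous_of_bound _ 1 fun f => by simpa using HSob.norm_toL2_le hr f

/-- Every measurable `m` with `⟨2πξ⟩ ^ r m ∈ L²` is the Fourier transform of an element
of `H ^ r`. -/
theorem HSob.exists_of_memLp {r : ℝ} (hr : 0 ≤ r) {m : E3 → ℂ}
    (hm : AEStronglyMeasurable m volume)
    (h : MemLp (fun ξ => (besselSymbol r ξ : ℂ) * m ξ) 2 volume) :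
    ∃ g : HSob r, ((𝓕 g.toL2 : L2) =ᵐ[volume] m) ∧
      ‖g‖ = (eLpNorm (fun ξ => (besselSymbol r ξ : ℂ) * m ξ) 2 volume).toReal := by
  have hm2 : MemLp m 2 volume := by
    refine h.of_le hm (ae_of_all _ fun ξ => ?_)
    rw [norm_mul, Complex.norm_real, Real.norm_of_nonneg (HSob.besselSymbol_pos r ξ).le]
    exact le_mul_of_one_le_left (norm_nonneg _) (one_le_besselSymbol hr ξ)
  have hF : (𝓕 (𝓕⁻ (hm2.toLp m) : L2) : L2) = hm2.toLp m := FourierTransform.fourier_fourierInv_eq _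
  have hFm : (𝓕 (𝓕⁻ (hm2.toLp m) : L2) : L2) =ᵐ[volume] m := by
    rw [hF]; exact hm2.coeFn_toLp
  have hae : (fun ξ => (besselSymbol r ξ : ℂ) * (𝓕 (𝓕⁻ (hm2.toLp m) : L2) : L2) ξ) =ᵐ[volume]
      fun ξ => (besselSymbol r ξ : ℂ) * m ξ := by
    filter_upwards [hFm] with ξ hξ
    rw [hξ]
  let g : HSob r := (⟨𝓕⁻ (hm2.toLp m), (memLp_congr_ae hae).mpr h⟩ : sobolevSubmodule r)
  refine ⟨g, hFm, ?_⟩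
  rw [HSob.norm_def, Lp.norm_def]
  congr 1
  exact eLpNorm_congr_ae ((coeFn_weightedFourier g).trans hae)

theorem abs_exp_sub_exp_le {a b c : ℝ} (ha : a ≤ c) (hb : b ≤ c) :
    |Real.exp a - Real.exp b| ≤ Real.exp c * |a - b| := by
  wlog hab : b ≤ a generalizing a b
  · rw [abs_sub_comm, abs_sub_comm a]
    exact this hb ha (le_of_not_ge hab)
  have h1 : Real.exp b = Real.exp a * Real.exp (b - a) := by rw [← Real.exp_add]; ring_nf
  have h2 := Real.add_one_le_exp (b - a)
  rw [abs_of_nonneg (sub_nonneg.mpr (Real.exp_le_exp.mpr hab)), abs_of_nonneg (by linarith)]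
  calc Real.exp a - Real.exp b = Real.exp a * (1 - Real.exp (b - a)) := by rw [h1]; ring
    _ ≤ Real.exp a * (a - b) := by
        refine mul_le_mul_of_nonneg_left (by linarith) (Real.exp_pos _).le
    _ ≤ Real.exp c * (a - b) := by
        refine mul_le_mul_of_nonneg_right (Real.exp_le_exp.mpr ha) (by linarith)

theorem memLp_gevreyWeight {r μ R : ℝ} (hμ : 0 ≤ μ) (hR : 0 ≤ R) (s : ℝ) (f : HSob r) :
    MemLp (fun ξ => ((gevreyWeight μ R s ξ * besselSymbol r ξ : ℝ) : ℂ) * (𝓕 f.toL2 : L2) ξ) 2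
      volume := by
  refine (f.memLp.const_mul (Real.exp (|s| * R) : ℂ)).of_le ?_ (ae_of_all _ fun ξ => ?_)
  · exact (Complex.continuous_ofReal.comp ((continuous_gevreyWeight μ R s).mul
      (continuous_besselSymbol r))).aestronglyMeasurable.mul (Lp.memLp _).1
  · have h1 : gevreyWeight μ R s ξ ≤ Real.exp (|s| * R) := by
      refine Real.exp_le_exp.mpr ?_
      have h0 : 0 ≤ min (μ * (2 * Real.pi * ‖ξ‖)) R := le_min (by positivity) hR
      exact mul_le_mul (le_abs_self s) (min_le_right _ _) h0 (abs_nonneg s)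
    rw [Complex.ofReal_mul, mul_assoc, norm_mul, norm_mul (Real.exp _ : ℂ), Complex.norm_real,
      Complex.norm_real, Real.norm_of_nonneg (gevreyWeight_pos μ R s ξ).le,
      Real.norm_of_nonneg (Real.exp_pos _).le]
    exact mul_le_mul_of_nonneg_right h1 (norm_nonneg _)

/-- The Fourier transform of `exp(s min(μ A, R)) ⟨A⟩ ^ r f`. -/
def gevreyFourier {r μ R : ℝ} (hμ : 0 ≤ μ) (hR : 0 ≤ R) (s : ℝ) (f : HSob r) : L2 :=
  (memLp_gevreyWeight hμ hR s f).toLp _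

theorem coeFn_gevreyFourier {r μ R : ℝ} (hμ : 0 ≤ μ) (hR : 0 ≤ R) (s : ℝ) (f : HSob r) :
    gevreyFourier hμ hR s f =ᵐ[volume] fun ξ =>
      ((gevreyWeight μ R s ξ * besselSymbol r ξ : ℝ) : ℂ) * (𝓕 f.toL2 : L2) ξ :=
  (memLp_gevreyWeight hμ hR s f).coeFn_toLp

theorem coeFn_gevreyFourier' {r μ R : ℝ} (hμ : 0 ≤ μ) (hR : 0 ≤ R) (s : ℝ) (f : HSob r) :
    gevreyFourier hμ hR s f =ᵐ[volume] fun ξ =>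
      (gevreyWeight μ R s ξ : ℂ) * HSob.weightedFourier f ξ := by
  filter_upwards [coeFn_gevreyFourier hμ hR s f, coeFn_weightedFourier f] with ξ h1 h2
  rw [h1, h2]; push_cast; ring

theorem norm_gevreyFourier_zero {r μ R : ℝ} (hμ : 0 ≤ μ) (hR : 0 ≤ R) (f : HSob r) :
    ‖gevreyFourier hμ hR 0 f‖ ≤ ‖f‖ := by
  rw [HSob.norm_def]
  refine Lp.norm_le_norm_of_ae_le ?_
  filter_upwards [coeFn_gevreyFourier' hμ hR 0 f] with ξ h1
  rw [h1]; simp [gevreyWeight]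

theorem norm_gevreyFourier_sub_le {r μ R t : ℝ} (hμ : 0 ≤ μ) (hR : 0 ≤ R) {s s' : ℝ}
    (hs : s ∈ Icc 0 t) (hs' : s' ∈ Icc 0 t) (f g : HSob r) :
    ‖gevreyFourier hμ hR s f - gevreyFourier hμ hR s' g‖ ≤
      Real.exp (t * R) * ‖f - g‖ + Real.exp (t * R) * R * |s - s'| * ‖g‖ := by
  have h1 : ‖gevreyFourier hμ hR s f - gevreyFourier hμ hR s g‖ ≤ Real.exp (t * R) * ‖f - g‖ := by
    rw [HSob.norm_def, map_sub]
    refine Lp.norm_le_mul_norm_of_ae_le_mul ?_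
    filter_upwards [coeFn_gevreyFourier' hμ hR s f, coeFn_gevreyFourier' hμ hR s g,
      Lp.coeFn_sub (gevreyFourier hμ hR s f) (gevreyFourier hμ hR s g),
      Lp.coeFn_sub (HSob.weightedFourier f) (HSob.weightedFourier g)] with ξ a1 a2 a3 a4
    rw [a3, a4, Pi.sub_apply, Pi.sub_apply, a1, a2, ← mul_sub, norm_mul, Complex.norm_real,
      Real.norm_of_nonneg (gevreyWeight_pos μ R s ξ).le]
    refine mul_le_mul_of_nonneg_right ((gevreyWeight_le hs.1 ξ).trans ?_) (norm_nonneg _)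
    exact Real.exp_le_exp.mpr (mul_le_mul_of_nonneg_right hs.2 hR)
  have h2 : ‖gevreyFourier hμ hR s g - gevreyFourier hμ hR s' g‖ ≤
      Real.exp (t * R) * R * |s - s'| * ‖g‖ := by
    rw [HSob.norm_def]
    refine Lp.norm_le_mul_norm_of_ae_le_mul ?_
    filter_upwards [coeFn_gevreyFourier' hμ hR s g, coeFn_gevreyFourier' hμ hR s' g,
      Lp.coeFn_sub (gevreyFourier hμ hR s g) (gevreyFourier hμ hR s' g)] with ξ a1 a2 a3
    rw [a3, Pi.sub_apply, a1, a2, ← sub_mul, norm_mul, ← Complex.ofReal_sub, Complex.norm_real,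
      Real.norm_eq_abs]
    refine mul_le_mul_of_nonneg_right ?_ (norm_nonneg _)
    set m := min (μ * (2 * Real.pi * ‖ξ‖)) R with hm
    have hm0 : 0 ≤ m := le_min (by positivity) hR
    have hmR : m ≤ R := min_le_right _ _
    have hb : ∀ σ ∈ Icc 0 t, σ * m ≤ t * R := fun σ hσ =>
      mul_le_mul hσ.2 hmR hm0 (hσ.1.trans hσ.2)
    refine (abs_exp_sub_exp_le (hb s hs) (hb s' hs')).trans ?_
    rw [← sub_mul, abs_mul, abs_of_nonneg hm0, mul_assoc (Real.exp _), mul_comm R]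
    gcongr
  calc _ = ‖(gevreyFourier hμ hR s f - gevreyFourier hμ hR s g) +
        (gevreyFourier hμ hR s g - gevreyFourier hμ hR s' g)‖ := by rw [sub_add_sub_cancel]
    _ ≤ _ := (norm_add_le _ _).trans (add_le_add h1 h2)

/-- Joint continuity of the truncated weighted norm, which the bootstrap needs; the truncation makes the
weight Lipschitz in `s`. -/
theorem continuousOn_gevreyFourier {r μ R t : ℝ} (hμ : 0 ≤ μ) (hR : 0 ≤ R) {f : ℝ → HSob r}
    (hf : ContinuousOn f (Icc 0 t)) :
    ContinuousOn (fun s => gevreyFourier hμ hR s (f s)) (Icc 0 t) := by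
  intro s₀ hs₀
  rw [ContinuousWithinAt, tendsto_iff_norm_sub_tendsto_zero]
  refine squeeze_zero' (Eventually.of_forall fun _ => norm_nonneg _)
    (eventually_nhdsWithin_of_forall fun s hs =>
      norm_gevreyFourier_sub_le hμ hR hs hs₀ (f s) (f s₀)) ?_
  have h1 : Tendsto (fun s => ‖f s - f s₀‖) (𝓝[Icc 0 t] s₀) (𝓝 0) :=
    tendsto_iff_norm_sub_tendsto_zero.mp (hf s₀ hs₀)
  have h2 : Tendsto (fun s => |s - s₀|) (𝓝[Icc 0 t] s₀) (𝓝 0) := by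
    refine (Continuous.tendsto' (by fun_prop) _ _ ?_).mono_left nhdsWithin_le_nhds
    simp
  simpa using (h1.const_mul (Real.exp (t * R))).add
    ((h2.const_mul (Real.exp (t * R) * R)).mul_const ‖f s₀‖)

/-- Continuity argument: a bound that improves itself holds throughout the interval. -/
theorem forall_lt_of_bootstrap {ι : Type*} [Finite ι] {t L : ℝ} {G : ι → ℝ → ℝ}
    (hG : ∀ j, ContinuousOn (G j) (Icc 0 t))
    (h : ∀ s ∈ Icc 0 t, (∀ σ ∈ Ico 0 s, ∀ j, G j σ < L) → ∀ j, G j s < L) :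
    ∀ s ∈ Icc 0 t, ∀ j, G j s < L := by
  by_contra! hcon
  obtain ⟨s, hs, j, hj⟩ := hcon
  have hcl : IsClosed (⋃ i, Icc 0 t ∩ G i ⁻¹' Ici L) :=
    isClosed_iUnion_of_finite fun i => (hG i).preimage_isClosed_of_isClosed isClosed_Icc isClosed_Ici
  have hcomp : IsCompact (⋃ i, Icc 0 t ∩ G i ⁻¹' Ici L) :=
    isCompact_Icc.of_isClosed_subset hcl (iUnion_subset fun i => inter_subset_left)
  obtain ⟨s₁, hs₁, hmin⟩ := hcomp.exists_isLeast ⟨s, mem_iUnion.mpr ⟨j, hs, hj⟩⟩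
  obtain ⟨i, hi, hiL⟩ := mem_iUnion.mp hs₁
  refine absurd (h s₁ hi (fun σ hσ k => ?_) i) (not_lt.mpr hiL)
  by_contra! hk
  exact absurd (hmin (mem_iUnion.mpr ⟨k, ⟨hσ.1, hσ.2.le.trans hi.2⟩, hk⟩)) (not_le.mpr hσ.2)

/-- The bootstrap: if `t` is so small that the nonlinear contribution is negligible, the truncated
Gevrey norm at time `t` is at most twice the size of its value for the linear heat flow. -/
theorem exists_gevreyFourier_bound {r : ℝ} (hr0 : 1 / 2 < r) (hr : r < 3 / 2) :
    ∃ C : ℝ, 0 ≤ C ∧ ∀ {T : ℝ} {u : ℝ → HVec r}, IsStrongSolution r T u →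
      ∀ {μ R t K : ℝ} (hμ : 0 ≤ μ) (hR : 0 ≤ R), 0 < t → t ≤ 1 → t ≤ T → 0 < K → ‖u 0‖ ≤ K →
      C * (1 + μ * √t) ^ 2 * Real.exp (t * μ ^ 2 / 4) * t ^ (r / 2 - 1 / 4) * (4 * K) < 1 →
      ∀ j, ‖gevreyFourier hμ hR t (u t j)‖ ≤ 2 * K * Real.exp (t * μ ^ 2 / 4) := by
  obtain ⟨C, hC0, hC⟩ := exists_apriori_bound hr0 hr
  refine ⟨C, hC0, ?_⟩
  intro T u hu μ R t K hμ hR ht ht1 htT hK hu0 hsmall j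
  have hcj : ∀ j, ContinuousOn (fun s => u s j) (Icc 0 T) := fun j =>
    (PiLp.continuous_apply 2 (fun _ : Fin 3 => HSob r) j).comp_continuousOn hu.continuousOn
  have hUc : ∀ j, ContinuousOn (fun s => (𝓕 (u s j).toL2 : L2)) (Icc 0 T) := fun j =>
    ((Lp.fourierTransformₗᵢ E3 ℂ).continuous.comp (HSob.continuous_toL2 (by linarith))).comp_continuousOn
      (hcj j)
  have hIcc : Icc 0 t ⊆ Icc 0 T := Icc_subset_Icc_right htT
  set G : Fin 3 → ℝ → ℝ := fun j s =>
    ‖gevreyFourier hμ hR s (u s j)‖ * Real.exp (-(s * μ ^ 2 / 4)) with hG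
  have hGc : ∀ j, ContinuousOn (G j) (Icc 0 t) := fun j =>
    (continuousOn_gevreyFourier hμ hR ((hcj j).mono hIcc)).norm.mul
      (Continuous.continuousOn (by fun_prop))
  have h0 : ∀ j, ‖gevreyFourier hμ hR 0 (u 0 j)‖ ≤ K := fun j =>
    (norm_gevreyFourier_zero hμ hR _).trans ((PiLp.norm_apply_le (u 0) j).trans hu0)
  have key := forall_lt_of_bootstrap (L := 2 * K) hGc (by
    intro s hs hlt i
    rcases eq_or_lt_of_le hs.1 with hs0 | hs0
    · rw [← hs0]
      simp only [hG, zero_mul, zero_div, neg_zero, Real.exp_zero, mul_one]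
      linarith [h0 i]
    · have h1 := hC hu hμ hR hs0 (hs.2.trans ht1) (hs.2.trans htT) (by positivity : 0 ≤ 2 * K)
        (fun σ l => gevreyFourier hμ hR σ (u σ l)) (fun σ _ l => coeFn_gevreyFourier hμ hR σ _) hUc
        (fun σ hσ l => by
          have := (hlt σ ⟨hσ.1.le, hσ.2⟩ l).le
          simp only [hG, Real.exp_neg] at this
          rwa [← div_eq_mul_inv, div_le_iff₀ (Real.exp_pos _)] at this) i
      have h2 : C * (1 + μ * √s) ^ 2 * Real.exp (s * μ ^ 2 / 4) * s ^ (r / 2 - 1 / 4) ≤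
          C * (1 + μ * √t) ^ 2 * Real.exp (t * μ ^ 2 / 4) * t ^ (r / 2 - 1 / 4) := by
        have := hs.2
        have e1 : √s ≤ √t := Real.sqrt_le_sqrt hs.2
        gcongr
        linarith
      simp only [hG, Real.exp_neg]
      rw [← div_eq_mul_inv, div_lt_iff₀ (Real.exp_pos _), mul_comm (2 * K)]
      refine h1.trans_lt (mul_lt_mul_of_pos_left ?_ (Real.exp_pos _))
      have h3 := mul_le_mul_of_nonneg_right h2 (by positivity : 0 ≤ (2 * K) ^ 2)
      have h4 := mul_lt_mul_of_pos_right hsmall hK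
      have h5 := h0 i
      nlinarith)
  have := (key t (right_mem_Icc.mpr ht.le) j).le
  simp only [hG, Real.exp_neg] at this
  rwa [← div_eq_mul_inv, div_le_iff₀ (Real.exp_pos _)] at this

/-- Removal of the truncation. -/
theorem exists_gevrey_of_bound {r μ t M : ℝ} (hr : 0 ≤ r) (hμ : 0 ≤ μ) (hM : 0 ≤ M) {f : HSob r}
    (h : ∀ R : ℝ, ∀ hR : 0 ≤ R, ‖gevreyFourier hμ hR t f‖ ≤ M) :
    ∃ g : HSob r, FunctionOfA (fun a => Real.exp (t * μ * a)) f.toL2 g.toL2 ∧ ‖g‖ ≤ M := by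
  set m : E3 → ℂ := fun ξ => (Real.exp (t * μ * (2 * Real.pi * ‖ξ‖)) : ℂ) * (𝓕 f.toL2 : L2) ξ with hm
  have hmm : AEStronglyMeasurable m volume :=
    (Continuous.aestronglyMeasurable (by fun_prop)).mul (Lp.memLp _).1
  have hle : eLpNorm (fun ξ => (besselSymbol r ξ : ℂ) * m ξ) 2 volume ≤ ENNReal.ofReal M := by
    refine eLpNorm_le_of_tendsto (f := fun n : ℕ => fun ξ =>
      ((gevreyWeight μ n t ξ * besselSymbol r ξ : ℝ) : ℂ) * (𝓕 f.toL2 : L2) ξ)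
      (fun n => (memLp_gevreyWeight hμ n.cast_nonneg t f).1) (ae_of_all _ fun ξ => ?_) fun n => ?_
    · obtain ⟨N, hN⟩ := exists_nat_ge (μ * (2 * Real.pi * ‖ξ‖))
      refine tendsto_const_nhds.congr' ?_
      filter_upwards [eventually_ge_atTop N] with n hn
      have : μ * (2 * Real.pi * ‖ξ‖) ≤ n := hN.trans (by exact_mod_cast hn)
      rw [gevreyWeight, min_eq_left this, hm]
      push_cast
      ring_nf
    · have := h n n.cast_nonneg
      rw [gevreyFourier, Lp.norm_toLp] at this
      exact (ENNReal.le_ofReal_iff_toReal_le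
        (memLp_gevreyWeight hμ n.cast_nonneg t f).eLpNorm_ne_top hM).mpr this
  have hmem : MemLp (fun ξ => (besselSymbol r ξ : ℂ) * m ξ) 2 volume :=
    ⟨(Complex.continuous_ofReal.comp (continuous_besselSymbol r)).aestronglyMeasurable.mul hmm,
      hle.trans_lt ENNReal.ofReal_lt_top⟩
  obtain ⟨g, hg, hgn⟩ := HSob.exists_of_memLp hr hmm hmem
  exact ⟨g, hg, hgn ▸ ENNReal.toReal_le_of_le_ofReal hM hle⟩

/-- The choice `t μ = √a √(t |ln t|)`: the linear growth `exp(t μ² / 4)` is `t ^ (-a/4)`. -/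
theorem gevrey_parameters {a t : ℝ} (ha : 0 ≤ a) (ht : 0 < t) (ht1 : t < 1) :
    (√a * √(t * |Real.log t|) / t * √t) ^ 2 = a * |Real.log t| ∧
    Real.exp (t * (√a * √(t * |Real.log t|) / t) ^ 2 / 4) = t ^ (-(a / 4)) := by
  have hl : 0 ≤ t * |Real.log t| := by positivity
  have h1 : (√a * √(t * |Real.log t|) / t) ^ 2 * t = a * |Real.log t| := by
    rw [div_pow, mul_pow, Real.sq_sqrt ha, Real.sq_sqrt hl]
    field_simp
  constructor
  · rw [mul_pow, Real.sq_sqrt ht.le, h1]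
  · rw [mul_comm t, h1, abs_of_neg (Real.log_neg ht ht1), Real.rpow_def_of_pos ht]
    congr 1; ring

theorem tendsto_log_mul_rpow_zero {a e C : ℝ} (he : 0 < e) :
    Tendsto (fun t : ℝ => C * (2 + 2 * (a * |Real.log t|)) * t ^ e) (𝓝[>] 0) (𝓝 0) := by
  have h1 : Tendsto (fun t : ℝ => |Real.log t * t ^ e|) (𝓝[>] 0) (𝓝 0) := by
    simpa using (tendsto_log_mul_rpow_nhdsGT_zero he).abs
  have h2 : Tendsto (fun t : ℝ => t ^ e) (𝓝[>] 0) (𝓝 0) := by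
    have : Tendsto (fun t : ℝ => t ^ e) (𝓝 0) (𝓝 (0 ^ e)) :=
      (Real.continuousAt_rpow_const 0 e (Or.inr he.le)).tendsto
    rw [Real.zero_rpow he.ne'] at this
    exact this.mono_left nhdsWithin_le_nhds
  have h3 := (h2.const_mul (2 * C)).add (h1.const_mul (2 * C * a))
  simp only [mul_zero, add_zero] at h3
  refine h3.congr' ?_
  filter_upwards [self_mem_nhdsWithin] with t ht
  have : 0 ≤ t ^ e := Real.rpow_nonneg (le_of_lt ht) e
  rw [abs_mul, abs_of_nonneg this]
  ring

/-- The nonlinear contribution to the bootstrap is of order `|ln t| t ^ (ε/4)`, so it is negligible for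
`t ≤ t₀`, with `t₀` depending on `r`, `ε` and `K` only. -/
theorem exists_gevrey_bound (r : ℝ) (hr : 1 / 2 < r) (hr' : r < 3 / 2) (ε : ℝ) (hε : 0 < ε)
    (hε' : ε ≤ 2 * r - 1) (K : ℝ) : ∃ t₀ : ℝ, 0 < t₀ ∧ ∃ C : ℝ, 0 < C ∧
      ∀ (u₀ : HVec r) (T : ℝ) (u : ℝ → HVec r),
        ‖u₀‖ ≤ K → 0 < T → IsStrongSolution r T u → u 0 = u₀ →
          ∀ t : ℝ, 0 < t → t ≤ t₀ → t ≤ T →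
            ∃ g : HVec r,
              (∀ j, FunctionOfA
                (fun a => Real.exp (√(2 * r - 1 - ε) * √(t * |Real.log t|) * a))
                (u t j).toL2 (g j).toL2) ∧
              ‖g‖ ≤ C * t ^ (1 / 4 + ε / 4 - r / 2) := by
  obtain ⟨C, hC0, hC⟩ := exists_gevreyFourier_bound hr hr'
  set a := 2 * r - 1 - ε with ha
  have ha0 : 0 ≤ a := by rw [ha]; linarith
  -- `K` may be zero or negative
  set K' := max K 1 with hK'
  have hK0 : 0 < K' := one_pos.trans_le (le_max_right _ _)
  have hev : ∀ᶠ t : ℝ in 𝓝[>] 0,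
      C * (4 * K') * (2 + 2 * (a * |Real.log t|)) * t ^ (ε / 4) < 1 :=
    (tendsto_log_mul_rpow_zero (by positivity)).eventually (gt_mem_nhds one_pos)
  obtain ⟨t₁, ht₁, hsub⟩ := mem_nhdsGT_iff_exists_Ioc_subset.mp hev
  refine ⟨min t₁ (1 / 2), lt_min ht₁ (by norm_num), 4 * K', by positivity, ?_⟩
  intro u₀ T u hu₀ hT hu hu0 t ht htt htT
  have ht1 : t < 1 := (htt.trans (min_le_right _ _)).trans_lt (by norm_num)
  have hsmall : C * (4 * K') * (2 + 2 * (a * |Real.log t|)) * t ^ (ε / 4) < 1 :=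
    hsub ⟨ht, htt.trans (min_le_left _ _)⟩
  set μ := √a * √(t * |Real.log t|) / t with hμd
  have hμ : 0 ≤ μ := by positivity
  obtain ⟨hp1, hp2⟩ := gevrey_parameters ha0 ht ht1
  rw [← hμd] at hp1 hp2
  have hexp : 1 / 4 + ε / 4 - r / 2 = -(a / 4) := by rw [ha]; ring
  have hsm : C * (1 + μ * √t) ^ 2 * Real.exp (t * μ ^ 2 / 4) * t ^ (r / 2 - 1 / 4) * (4 * K') < 1 := by
    refine lt_of_le_of_lt ?_ hsmall
    have h1 : (1 + μ * √t) ^ 2 ≤ 2 + 2 * (a * |Real.log t|) := by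
      rw [← hp1]; nlinarith [sq_nonneg (1 - μ * √t)]
    have h2 : t ^ (-(a / 4)) * t ^ (r / 2 - 1 / 4) = t ^ (ε / 4) := by
      rw [← Real.rpow_add ht]; congr 1; rw [ha]; ring
    rw [hp2]
    calc _ = C * (4 * K') * (1 + μ * √t) ^ 2 * (t ^ (-(a / 4)) * t ^ (r / 2 - 1 / 4)) := by ring
      _ ≤ _ := by rw [h2]; gcongr
  have hbd : ∀ j, ∃ g : HSob r, FunctionOfA (fun x => Real.exp (t * μ * x)) (u t j).toL2 g.toL2 ∧
      ‖g‖ ≤ 2 * K' * t ^ (-(a / 4)) := fun j =>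
    exists_gevrey_of_bound (by linarith) hμ (by positivity) fun R hR => by
      have := hC hu hμ hR ht ht1.le htT hK0 (hu0 ▸ hu₀.trans (le_max_left _ _)) hsm j
      rwa [hp2] at this
  choose g hg hgn using hbd
  refine ⟨WithLp.toLp 2 g, fun j => ?_, ?_⟩
  · have htμ : t * μ = √a * √(t * |Real.log t|) := by rw [hμd]; field_simp
    have := hg j
    rwa [htμ] at this
  · rw [hexp]
    set M := 2 * K' * t ^ (-(a / 4)) with hM
    have hM0 : 0 ≤ M := by positivity
    -- three components of norm at most `M`, and `3 ≤ 2²`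
    have h1 : ‖(WithLp.toLp 2 g : HVec r)‖ ^ 2 ≤ (2 * M) ^ 2 := by
      rw [PiLp.norm_sq_eq_of_L2]
      calc ∑ i, ‖g i‖ ^ 2 ≤ ∑ _i : Fin 3, M ^ 2 := by
            gcongr with i
            exact hgn i
        _ ≤ _ := by
            simp only [Finset.sum_const, Finset.card_univ, Fintype.card_fin, nsmul_eq_mul]
            push_cast
            nlinarith [sq_nonneg M]
    have h2 := abs_le_of_sq_le_sq h1 (by positivity)
    rw [abs_of_nonneg (norm_nonneg _)] at h2
    refine h2.trans (le_of_eq ?_)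
    rw [hM]; ring

/-! ### Analyticity radius -/

theorem HSob.norm_le_mul_norm {r c : ℝ} {f g : HSob r}
    (h : ∀ᵐ ξ : E3, ‖(𝓕 f.toL2 : L2) ξ‖ ≤ c * ‖(𝓕 g.toL2 : L2) ξ‖) : ‖f‖ ≤ c * ‖g‖ := by
  rw [HSob.norm_def, HSob.norm_def]
  refine Lp.norm_le_mul_norm_of_ae_le_mul ?_
  filter_upwards [h, coeFn_weightedFourier f, coeFn_weightedFourier g] with ξ h1 h2 h3
  rw [h2, h3, norm_mul, norm_mul, mul_left_comm]
  exact mul_le_mul_of_nonneg_left h1 (norm_nonneg _)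

/-- If `exp(a A) f ∈ H ^ r`, then `m(D) f ∈ H ^ r` for every continuous symbol `m` of size
`O(exp(a |2πξ|))`. -/
theorem HSob.exists_multiplier {r a c : ℝ} (hr : 0 ≤ r) {f g : HSob r}
    (hfg : FunctionOfA (fun x => Real.exp (a * x)) f.toL2 g.toL2) {m : E3 → ℂ}
    (hm : Continuous m) (hmc : ∀ ξ, ‖m ξ‖ ≤ c * Real.exp (a * (2 * Real.pi * ‖ξ‖))) :
    ∃ h : HSob r, ∀ᵐ ξ : E3, (𝓕 h.toL2 : L2) ξ = m ξ * (𝓕 f.toL2 : L2) ξ := by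
  have hmeas : AEStronglyMeasurable (fun ξ => m ξ * (𝓕 f.toL2 : L2) ξ) volume :=
    hm.aestronglyMeasurable.mul (Lp.memLp _).1
  obtain ⟨h, hh, -⟩ := HSob.exists_of_memLp hr hmeas <| by
    refine g.memLp.of_le_mul (c := c) ?_ ?_
    · exact (Complex.continuous_ofReal.comp
        (continuous_besselSymbol r)).aestronglyMeasurable.mul hmeas
    · filter_upwards [hfg] with ξ hξ
      rw [hξ, norm_mul, norm_mul, norm_mul, norm_mul, mul_left_comm c, ← mul_assoc c,
        Complex.norm_real (Real.exp _), Real.norm_of_nonneg (Real.exp_pos _).le]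
      gcongr
      exact hmc ξ
  exact ⟨h, hh⟩

/-- The phase `2πi ξ · η` for a complex vector `η`, with the bilinear dot product. -/
def complexPhase (ξ : E3) (η : EuclideanSpace ℂ (Fin 3)) : ℂ :=
  2 * Real.pi * Complex.I * ∑ i, (ξ i : ℂ) * η i

theorem complexPhase_add (ξ : E3) (η h : EuclideanSpace ℂ (Fin 3)) :
    complexPhase ξ (η + h) = complexPhase ξ η + complexPhase ξ h := by
  simp only [complexPhase, PiLp.add_apply, mul_add, Finset.sum_add_distrib]

theorem continuous_complexPhase (η : EuclideanSpace ℂ (Fin 3)) :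
    Continuous fun ξ => complexPhase ξ η := by
  unfold complexPhase; fun_prop

theorem norm_complexPhase_le (ξ : E3) (η : EuclideanSpace ℂ (Fin 3)) :
    ‖complexPhase ξ η‖ ≤ 2 * Real.pi * ‖ξ‖ * ‖η‖ := by
  have h1 : ‖∑ i, (ξ i : ℂ) * η i‖ ≤ ‖ξ‖ * ‖η‖ := by
    calc ‖∑ i, (ξ i : ℂ) * η i‖ ≤ ∑ i, ‖ξ i‖ * ‖η i‖ := by
          refine (norm_sum_le _ _).trans (le_of_eq ?_)
          simp only [norm_mul, Complex.norm_real]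
      _ ≤ √(∑ i, ‖ξ i‖ ^ 2) * √(∑ i, ‖η i‖ ^ 2) := Real.sum_mul_le_sqrt_mul_sqrt _ _ _
      _ = _ := by rw [EuclideanSpace.norm_eq, EuclideanSpace.norm_eq]
  rw [complexPhase, norm_mul]
  have h2 : ‖(2 * Real.pi * Complex.I : ℂ)‖ = 2 * Real.pi := by
    simp [abs_of_pos Real.pi_pos]
  rw [h2, mul_assoc (2 * Real.pi)]
  gcongr

/-- The imaginary part of a complex vector, as a real vector. -/
def imVec (η : EuclideanSpace ℂ (Fin 3)) : E3 := WithLp.toLp 2 fun i => (η i).im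

theorem norm_imVec_le (η : EuclideanSpace ℂ (Fin 3)) : ‖imVec η‖ ≤ ‖η‖ := by
  rw [EuclideanSpace.norm_eq, EuclideanSpace.norm_eq]
  refine Real.sqrt_le_sqrt (Finset.sum_le_sum fun i _ => ?_)
  have : ‖imVec η i‖ ≤ ‖η i‖ := Complex.abs_im_le_norm (η i)
  gcongr

theorem imVec_add (η h : EuclideanSpace ℂ (Fin 3)) : imVec (η + h) = imVec η + imVec h := by
  ext i; simp [imVec]

theorem norm_exp_complexPhase_le (ξ : E3) (η : EuclideanSpace ℂ (Fin 3)) :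
    ‖Complex.exp (complexPhase ξ η)‖ ≤ Real.exp (‖imVec η‖ * (2 * Real.pi * ‖ξ‖)) := by
  rw [Complex.norm_exp, Real.exp_le_exp]
  have h1 : (complexPhase ξ η).re = -(2 * Real.pi) * inner ℝ ξ (imVec η) := by
    simp [complexPhase, PiLp.inner_apply, imVec, Fin.sum_univ_three]
    ring
  have h2 := (abs_le.mp (abs_real_inner_le_norm ξ (imVec η))).1
  rw [h1]
  nlinarith [Real.pi_pos]

theorem sq_mul_exp_le {k δ : ℝ} (hk : 0 ≤ k) (hδ : 0 < δ) : k ^ 2 ≤ 2 / δ ^ 2 * Real.exp (k * δ) := by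
  have h1 := Real.quadratic_le_exp_of_nonneg (mul_nonneg hk hδ.le)
  have h2 : (k * δ) ^ 2 / 2 ≤ Real.exp (k * δ) := by
    have := mul_nonneg hk hδ.le
    linarith
  calc k ^ 2 = 2 / δ ^ 2 * ((k * δ) ^ 2 / 2) := by field_simp
    _ ≤ _ := by gcongr

theorem mul_exp_le {k δ : ℝ} (hδ : 0 < δ) : k ≤ 1 / δ * Real.exp (k * δ) := by
  have h1 := Real.add_one_le_exp (k * δ)
  calc k = 1 / δ * (k * δ) := by field_simp
    _ ≤ _ := by gcongr; linarith

/-- If `exp(a A) f ∈ H ^ r`, then multiplication of `𝓕 f` by `exp(2πi ξ · η)` extends the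
translates of `f` to a bounded holomorphic function of `η` in the tube `|Im η| < a`. -/
theorem hasBoundedExtension_of_functionOfA {r a : ℝ} (hr : 0 ≤ r) {f g : HSob r}
    (ha : 0 < a) (hfg : FunctionOfA (fun x => Real.exp (a * x)) f.toL2 g.toL2) :
    HasBoundedExtension f a := by
  have htube : ∀ η, η ∈ tube a ↔ ‖imVec η‖ < a := fun η => Iff.rfl
  have hex : ∀ η, ∃ h : HSob r, η ∈ tube a → ∀ᵐ ξ : E3,
      (𝓕 h.toL2 : L2) ξ = Complex.exp (complexPhase ξ η) * (𝓕 f.toL2 : L2) ξ := by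
    intro η
    by_cases hη : η ∈ tube a
    · obtain ⟨h, hh⟩ := HSob.exists_multiplier (c := 1) hr hfg
        (Complex.continuous_exp.comp (continuous_complexPhase η)) fun ξ => by
          refine (norm_exp_complexPhase_le ξ η).trans ?_
          rw [one_mul]
          gcongr
          exact ((htube η).mp hη).le
      exact ⟨h, fun _ => hh⟩
    · exact ⟨0, fun h => absurd h hη⟩
  choose F hF using hex
  refine ⟨F, fun η hη => ?_, fun y => ?_, ‖g‖, fun η hη => ?_⟩
  · set b := ‖imVec η‖ with hb
    have hba : b < a := hη
    -- half of the distance to the boundary of the tube: `b + 2δ = a` leaves room for the increment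
    -- and for the factor `k²`
    set δ := (a - b) / 2 with hδd
    have hδ : 0 < δ := by rw [hδd]; linarith
    have hG : ∀ i : Fin 3, ∃ h : HSob r, ∀ᵐ ξ : E3, (𝓕 h.toL2 : L2) ξ =
        (2 * Real.pi * Complex.I * (ξ i : ℂ) * Complex.exp (complexPhase ξ η)) *
          (𝓕 f.toL2 : L2) ξ := by
      intro i
      refine HSob.exists_multiplier (c := 1 / (a - b)) hr hfg ?_ fun ξ => ?_
      · have := continuous_complexPhase η
        fun_prop
      · have h1 : ‖(2 * Real.pi * Complex.I * (ξ i : ℂ) : ℂ)‖ ≤ 2 * Real.pi * ‖ξ‖ := by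
          have := PiLp.norm_apply_le ξ i
          simp only [norm_mul, Complex.norm_real, Complex.norm_I, mul_one, Complex.norm_ofNat,
            Real.norm_of_nonneg Real.pi_pos.le]
          gcongr
        have h2 := norm_exp_complexPhase_le ξ η
        rw [norm_mul]
        calc _ ≤ (2 * Real.pi * ‖ξ‖) * Real.exp (b * (2 * Real.pi * ‖ξ‖)) := by gcongr
          _ ≤ (1 / (a - b) * Real.exp ((2 * Real.pi * ‖ξ‖) * (a - b))) *
              Real.exp (b * (2 * Real.pi * ‖ξ‖)) := by
            exact mul_le_mul_of_nonneg_right (mul_exp_le (sub_pos.mpr hba)) (Real.exp_pos _).le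
          _ = _ := by rw [mul_assoc, ← Real.exp_add]; ring_nf
    choose G hG using hG
    -- the derivative at `η`, whose components have Fourier transforms `2πi ξ_i exp(2πi ξ · η) 𝓕 f`
    let L : EuclideanSpace ℂ (Fin 3) →L[ℂ] HSob r :=
      ∑ i, (EuclideanSpace.proj i : EuclideanSpace ℂ (Fin 3) →L[ℂ] ℂ).smulRight (G i)
    have hL : ∀ h, L h = ∑ i, h i • G i := fun h => by
      simp [L]
    have hbound : ∀ h, ‖h‖ < δ → ‖F (η + h) - F η - L h‖ ≤ 2 / δ ^ 2 * ‖h‖ ^ 2 * ‖g‖ := by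
      intro h hh
      have hηh : η + h ∈ tube a := by
        rw [htube, imVec_add]
        have h1 := norm_add_le (imVec η) (imVec h)
        have h2 := norm_imVec_le h
        rw [hδd] at hh
        linarith
      refine HSob.norm_le_mul_norm ?_
      have hfour : (𝓕 (F (η + h) - F η - L h).toL2 : L2) =
          𝓕 (F (η + h)).toL2 - 𝓕 (F η).toL2 - ∑ i, h i • (𝓕 (G i).toL2 : L2) := by
        rw [hL]
        change Lp.fourierTransformₗᵢ E3 ℂ _ = Lp.fourierTransformₗᵢ E3 ℂ _ -
          Lp.fourierTransformₗᵢ E3 ℂ _ - ∑ i, h i • Lp.fourierTransformₗᵢ E3 ℂ _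
        simp only [map_sub, map_sum, map_smul]
      rw [hfour]
      filter_upwards [hF _ hηh, hF _ hη, hG 0, hG 1, hG 2, hfg,
        Lp.coeFn_sub (𝓕 (F (η + h)).toL2 - 𝓕 (F η).toL2 : L2) (∑ i, h i • (𝓕 (G i).toL2 : L2)),
        Lp.coeFn_sub (𝓕 (F (η + h)).toL2 : L2) (𝓕 (F η).toL2),
        Lp.coeFn_finsetSum Finset.univ fun i => h i • (𝓕 (G i).toL2 : L2),
        Lp.coeFn_smul (h 0) (𝓕 (G 0).toL2 : L2), Lp.coeFn_smul (h 1) (𝓕 (G 1).toL2 : L2),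
        Lp.coeFn_smul (h 2) (𝓕 (G 2).toL2 : L2)] with ξ e1 e2 g0 g1 g2 eg s1 s2 s3 m0 m1 m2
      have hval : ((𝓕 (F (η + h)).toL2 - 𝓕 (F η).toL2 - ∑ i, h i • (𝓕 (G i).toL2 : L2) : L2) :
          E3 → ℂ) ξ = Complex.exp (complexPhase ξ η) *
            (Complex.exp (complexPhase ξ h) - 1 - complexPhase ξ h) * (𝓕 f.toL2 : L2) ξ := by
        rw [s1, Pi.sub_apply, s2, Pi.sub_apply, s3, Finset.sum_apply, Fin.sum_univ_three, m0, m1,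
          m2, Pi.smul_apply, Pi.smul_apply, Pi.smul_apply, g0, g1, g2, e1, e2, complexPhase_add,
          Complex.exp_add]
        have : complexPhase ξ h = 2 * Real.pi * Complex.I *
            ((ξ 0 : ℂ) * h 0 + (ξ 1 : ℂ) * h 1 + (ξ 2 : ℂ) * h 2) := by
          rw [complexPhase, Fin.sum_univ_three]
        rw [this]
        simp only [smul_eq_mul]
        ring
      rw [hval, eg, norm_mul, norm_mul, norm_mul (Complex.ofReal _), Complex.norm_real,
        Real.norm_of_nonneg (Real.exp_pos _).le, ← mul_assoc]
      refine mul_le_mul_of_nonneg_right ?_ (norm_nonneg _)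
      set k := 2 * Real.pi * ‖ξ‖ with hk
      have hk0 : 0 ≤ k := by positivity
      have t1 : ‖Complex.exp (complexPhase ξ h) - 1 - complexPhase ξ h‖ ≤
          (k * ‖h‖) ^ 2 * Real.exp (k * δ) := by
        have := Complex.norm_exp_sub_sum_le_norm_mul_exp (complexPhase ξ h) 2
        simp only [Finset.sum_range_succ, Finset.sum_range_zero, pow_zero, pow_one,
          Nat.factorial, Nat.cast_one, zero_add, div_one, mul_one, ← sub_sub] at this
        refine this.trans ?_
        have h3 := norm_complexPhase_le ξ h
        rw [← hk] at h3
        gcongr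
        exact h3.trans (by gcongr)
      calc _ ≤ Real.exp (b * k) * ((k * ‖h‖) ^ 2 * Real.exp (k * δ)) :=
            mul_le_mul (norm_exp_complexPhase_le ξ η) t1 (norm_nonneg _) (Real.exp_pos _).le
        _ = k ^ 2 * (‖h‖ ^ 2 * (Real.exp (b * k) * Real.exp (k * δ))) := by ring
        _ ≤ (2 / δ ^ 2 * Real.exp (k * δ)) *
            (‖h‖ ^ 2 * (Real.exp (b * k) * Real.exp (k * δ))) := by
          gcongr
          exact sq_mul_exp_le hk0 hδ
        _ = 2 / δ ^ 2 * ‖h‖ ^ 2 * (Real.exp (k * δ) * Real.exp (b * k) * Real.exp (k * δ)) := by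
          ring
        _ = _ := by
          rw [← Real.exp_add, ← Real.exp_add]
          congr 2
          rw [hδd]; ring
    have hder : HasFDerivAt F L η := by
      rw [hasFDerivAt_iff_isLittleO_nhds_zero]
      have hO : (fun h => F (η + h) - F η - L h) =O[𝓝 0] fun h => ‖h‖ ^ 2 := by
        refine Asymptotics.IsBigO.of_bound (2 / δ ^ 2 * ‖g‖) ?_
        filter_upwards [Metric.ball_mem_nhds (0 : EuclideanSpace ℂ (Fin 3)) hδ] with h hh
        rw [Real.norm_of_nonneg (by positivity)]
        refine (hbound h (by simpa using hh)).trans (le_of_eq (by ring))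
      exact hO.trans_isLittleO (Asymptotics.isLittleO_norm_pow_id one_lt_two)
    exact hder.differentiableAt.differentiableWithinAt
  · refine translation_of_fourier_eq y ?_
    have hy : (WithLp.toLp 2 fun i => (y i : ℂ) : EuclideanSpace ℂ (Fin 3)) ∈ tube a := by
      rw [htube]
      have : imVec (WithLp.toLp 2 fun i => (y i : ℂ)) = 0 := by ext i; simp [imVec]
      rwa [this, norm_zero]
    filter_upwards [hF _ hy] with ξ hξ
    rw [hξ]
    congr 2
    simp [complexPhase, PiLp.inner_apply, Fin.sum_univ_three]
    ring
  · refine (HSob.norm_le_mul_norm (c := 1) ?_).trans_eq (one_mul _)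
    filter_upwards [hF _ hη, hfg] with ξ h1 h2
    rw [h1, h2, norm_mul, norm_mul, one_mul, Complex.norm_real,
      Real.norm_of_nonneg (Real.exp_pos _).le]
    gcongr
    refine (norm_exp_complexPhase_le ξ η).trans ?_
    gcongr
    exact ((htube η).mp hη).le

theorem ofReal_le_radVec {r a : ℝ} (hr : 0 ≤ r) {u g : HVec r}
    (h : ∀ j, FunctionOfA (fun x => Real.exp (a * x)) (u j).toL2 (g j).toL2) :
    ENNReal.ofReal a ≤ radVec u := by
  rcases le_or_gt a 0 with ha | ha
  · simp [ENNReal.ofReal_of_nonpos ha]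
  · exact le_iInf fun j => le_iSup₂_of_le a
      ⟨ha, hasBoundedExtension_of_functionOfA hr ha (h j)⟩ le_rfl

/-- The quantitative bound for every `ε > 0`, and `ε → 0`. -/
theorem le_liminf_radVec {r T : ℝ} (hr : 1 / 2 < r) (hr' : r < 3 / 2) {u : ℝ → HVec r}
    (hT : 0 < T) (hu : IsStrongSolution r T u) :
    ENNReal.ofReal √(2 * r - 1) ≤
      liminf (fun t : ℝ => radVec (u t) / ENNReal.ofReal √(t * |Real.log t|)) (𝓝[>] 0) := by
  have hε : ∀ ε ∈ Ioo 0 (2 * r - 1), ENNReal.ofReal √(2 * r - 1 - ε) ≤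
      liminf (fun t : ℝ => radVec (u t) / ENNReal.ofReal √(t * |Real.log t|)) (𝓝[>] 0) := by
    intro ε hε
    obtain ⟨t₀, ht₀, C, -, h⟩ := exists_gevrey_bound r hr hr' ε hε.1 hε.2.le ‖u 0‖
    refine le_liminf_of_le (by isBoundedDefault) ?_
    filter_upwards [Ioo_mem_nhdsGT (lt_min (lt_min ht₀ hT) one_pos)] with t ht
    obtain ⟨⟨h1, h2⟩, h3⟩ : (t < t₀ ∧ t < T) ∧ t < 1 := by simpa using ht.2
    obtain ⟨g, hg, -⟩ := h (u 0) T u le_rfl hT hu rfl t ht.1 h1.le h2.le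
    have hpos : 0 < √(t * |Real.log t|) :=
      Real.sqrt_pos.mpr (mul_pos ht.1 (abs_pos.mpr (Real.log_neg ht.1 h3).ne))
    rw [ENNReal.le_div_iff_mul_le (Or.inl (ENNReal.ofReal_pos.mpr hpos).ne') (Or.inl ENNReal.ofReal_ne_top),
      ← ENNReal.ofReal_mul (Real.sqrt_nonneg _)]
    exact ofReal_le_radVec (by linarith) hg
  have hlim : Tendsto (fun ε : ℝ => ENNReal.ofReal √(2 * r - 1 - ε)) (𝓝[>] 0)
      (𝓝 (ENNReal.ofReal √(2 * r - 1))) := by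
    refine Tendsto.mono_left ?_ nhdsWithin_le_nhds
    exact (ENNReal.continuous_ofReal.comp (by fun_prop)).tendsto' _ _ (by simp)
  refine le_of_tendsto hlim ?_
  filter_upwards [Ioo_mem_nhdsGT (show (0 : ℝ) < 2 * r - 1 by linarith)] with ε h
  exact hε ε h

end NavierStokes

end

open NavierStokes in
theorem theorem1p2 (r : ℝ) (hr : 1 / 2 < r) (hr' : r < 3 / 2) :
    (∀ ε : ℝ, 0 < ε → ε ≤ 2 * r - 1 → ∀ K : ℝ, ∃ t₀ : ℝ, 0 < t₀ ∧ ∃ C : ℝ, 0 < C ∧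
      ∀ (u₀ : HVec r) (T : ℝ) (u : ℝ → HVec r),
        ‖u₀‖ ≤ K → 0 < T → IsStrongSolution r T u → u 0 = u₀ →
          ∀ t : ℝ, 0 < t → t ≤ t₀ → t ≤ T →
            ∃ g : HVec r,
              (∀ j, FunctionOfA
                (fun a => Real.exp (√(2 * r - 1 - ε) * √(t * |Real.log t|) * a))
                (u t j).toL2 (g j).toL2) ∧
              ‖g‖ ≤ C * t ^ (1 / 4 + ε / 4 - r / 2)) ∧
    (∀ (u₀ : HVec r) (T : ℝ) (u : ℝ → HVec r),
      0 < T → IsStrongSolution r T u → u 0 = u₀ →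
        ENNReal.ofReal √(2 * r - 1) ≤
          liminf (fun t : ℝ => radVec (u t) / ENNReal.ofReal √(t * |Real.log t|)) (𝓝[>] 0)) :=
  ⟨fun ε hε hε' K => exists_gevrey_bound r hr hr' ε hε hε' K,
    fun _ _ _ hT hu _ => le_liminf_radVec hr hr' hT hu⟩
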